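/- Let $(X,Y)$ have joint law $P$ on $\mathcal X\times\mathbb R$, with $Y\in\mathcal Y\subset\mathbb R$, $Y$ integrable and with a continuous (atomless) distribution with CDF $F_Y$. Let $\phi$ be convex on $\mathcal Y$ with $\phi(Y)$ integrable, let $d_\phi(t,z)=\phi(t)-\phi(z)-(t-z)\phi'(z)$ be its Bregman divergence, and let $R(h)=\mathbb E[d_\phi(Y,h(X))]$ be the risk of a measurable model $h:\mathcal X\to\mathcal Y$ from a class $\mathcal H$ ($\phi$ is differentiable at the values of the models). The pair $(X^+,X^-)$ is obtained from two independent copies $(X,Y),(X',Y')$ by $(X^+,X^-)=(X,X')$ if $Y\ge Y'$ and $(X',X)$ if $Y<Y'$. From independent samples, namely $n_U\ge1$ i.i.d. copies $x_i$ of $X$ and $n_R\ge1$ i.i.d. copies $(x_i^+,x_i^-)$ of $(X^+,X^-)$, and for constants $\lambda,w_1,w_2\in\mathbb R$, form $$\hat R_{RA}(h)=\mathbb E[\phi(Y)]-\frac1{n_U}\sum_{i=1}^{n_U}\bigl(\phi(h(x_i))-(h(x_i)-\lambda)\phi'(h(x_i))\bigr)-\frac1{n_R}\sum_{i=1}^{n_R}\Bigl(\bigl(w_1-\tfrac\lambda2\bigr)\phi'(h(x_i^+))+\bigl(w_2-\tfrac\lambda2\bigr)\phi'(h(x_i^-))\Bigr).$$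 Let $\hat h_{RA}$ be a (measurably chosen) minimizer of $\hat R_{RA}$ over $\mathcal H$ and $h^*$ a minimizer of $R$ over $\mathcal H$. Assume that the classes $\{x\mapsto\phi'(h(x)) : h\in\mathcal H\}$ and $\{x\mapsto h(x)\phi'(h(x))-\phi(h(x)) : h\in\mathcal H\}$ have finite pseudo-dimensions, at most $d$ and $d'$, and that $|\phi'(h(x))|\le M$ and $|h(x)\phi'(h(x))-\phi(h(x))|\le m$ for all $x\in\mathcal X$, $h\in\mathcal H$. Put $$\mathrm{Err}(w_1,w_2)=\mathbb E\bigl|Y-2w_1F_Y(Y)-2w_2(1-F_Y(Y))\bigr|.$$ Then for every $\delta_0<1$ there are constants $C_U,C_R$, depending only on $d,d',m,M,\lambda,w_1,w_2,\delta_0$, such that for all $n_U,n_R\ge1$ and all $\delta\in(0,\delta_0]$, with probability at least $1-\delta$, $$R(\hat h_{RA})\le R(h^*)+C_U\sqrt{\frac{\log(1/\delta)}{n_U}}+C_R\sqrt{\frac{\log(1/\delta)}{n_R}}+2M\,\mathrm{Err}(w_1,w_2).$$ In particular, if $Y$ is uniformly distributed on $[a,b]$ with $a<b$, then $\mathrm{Err}(b/2,a/2)=0$,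 and with $(w_1,w_2)=(b/2,a/2)$ the estimator is consistent: $R(\hat h_{RA})\to R(h^*)$ in probability as $n_U,n_R\to\infty$. -/

import Mathlib

open MeasureTheory ProbabilityTheory Filter Topology

universe u

noncomputable section

namespace UncoupledRegression

/-- The Bregman divergence `d_φ(t, z)`: `t` is the true target, `z` the prediction. -/
def bregman (φ : ℝ → ℝ) (t z : ℝ) : ℝ :=
  φ t - φ z - (t - z) * deriv φ z

/-- A finite set `S` is pseudo-shattered by a class `F` of real functions: for some thresholds
`r`, every subset of `S` is cut out by the strict superlevel relation of a member of `F`. -/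
def PseudoShatters {X : Type u} (F : Set (X → ℝ)) (S : Finset X) : Prop :=
  ∃ r : X → ℝ, ∀ T ⊆ S, ∃ f ∈ F, ∀ x ∈ S, r x < f x ↔ x ∈ T

/-- The pseudo-dimension: the supremum of the sizes of the pseudo-shattered finite sets. -/
def pseudoDim {X : Type u} (F : Set (X → ℝ)) : ℕ∞ :=
  ⨆ (S : Finset X) (_ : PseudoShatters F S), (S.card : ℕ∞)

/-- The class `{x ↦ φ'(h x) | h ∈ H}`. -/
def derivClass {X : Type u} (φ : ℝ → ℝ) (H : Set (X → ℝ)) : Set (X → ℝ) :=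
  (fun (h : X → ℝ) (x : X) => deriv φ (h x)) '' H

/-- The class `{x ↦ h x * φ'(h x) - φ (h x) | h ∈ H}`. -/
def conjClass {X : Type u} (φ : ℝ → ℝ) (H : Set (X → ℝ)) : Set (X → ℝ) :=
  (fun (h : X → ℝ) (x : X) => h x * deriv φ (h x) - φ (h x)) '' H

/-- The unlabeled sample (`nU` points) together with the comparison sample (`nR` pairs
`(x⁺, x⁻)`). -/
abbrev RAData (X : Type u) (nU nR : ℕ) : Type u :=
  (Fin nU → X) × (Fin nR → X × X)

variable {X : Type u} [MeasurableSpace X]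

/-- The expected loss `R(h) = E[d_φ(Y, h(X))]`, where `P` is the law of `(X, Y)`. -/
def risk (P : Measure (X × ℝ)) (φ : ℝ → ℝ) (h : X → ℝ) : ℝ :=
  ∫ p, bregman φ p.2 (h p.1) ∂P

/-- The joint law of `(X⁺, X⁻)`: two independent draws `(X, Y)`, `(X', Y')` from `P`, ordered by
their targets. -/
def pairLaw (P : Measure (X × ℝ)) : Measure (X × X) :=
  (P.prod P).map fun q => if q.2.2 ≤ q.1.2 then (q.1.1, q.2.1) else (q.2.1, q.1.1)

/-- The law of the data: i.i.d. unlabeled points, and independently i.i.d. comparison pairs. -/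
def dataLaw (P : Measure (X × ℝ)) (nU nR : ℕ) : Measure (RAData X nU nR) :=
  (Measure.pi fun _ : Fin nU => P.fst).prod (Measure.pi fun _ : Fin nR => pairLaw P)

/-- The empirical approximated risk; `∫ y, φ y ∂P.snd` is the constant `E[φ(Y)]`. -/
def empRisk (P : Measure (X × ℝ)) (φ : ℝ → ℝ) (lam w₁ w₂ : ℝ) {nU nR : ℕ}
    (D : RAData X nU nR) (h : X → ℝ) : ℝ :=
  (∫ y, φ y ∂P.snd)
    - (1 / (nU : ℝ)) * ∑ i, (φ (h (D.1 i)) - (h (D.1 i) - lam) * deriv φ (h (D.1 i)))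
    - (1 / (nR : ℝ)) * ∑ i, ((w₁ - lam / 2) * deriv φ (h (D.2 i).1)
        + (w₂ - lam / 2) * deriv φ (h (D.2 i).2))

/-- `Err(w₁, w₂) = E|Y - 2 w₁ F_Y(Y) - 2 w₂ (1 - F_Y(Y))|`. -/
def Err (P : Measure (X × ℝ)) (w₁ w₂ : ℝ) : ℝ :=
  ∫ y, |y - 2 * w₁ * cdf P.snd y - 2 * w₂ * (1 - cdf P.snd y)| ∂P.snd

/-- The uncoupled regression problem: `P` is the law of `(X, Y)`, `Ys` the target space, `φ` the
convex generator of the loss, `H` the class of models with values in `Ys`. The bounds `m`, `M` are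
those on `|h φ'(h) - φ(h)|` and `|φ'(h)|`. -/
structure IsProblem (P : Measure (X × ℝ)) (Ys : Set ℝ) (φ : ℝ → ℝ) (H : Set (X → ℝ))
    (m M : ℝ) : Prop where
  target_mem : ∀ᵐ y ∂P.snd, y ∈ Ys
  target_continuous : ∀ y : ℝ, P.snd {y} = 0
  target_integrable : Integrable (fun y : ℝ => y) P.snd
  generator_integrable : Integrable φ P.snd
  generator_convex : ConvexOn ℝ Ys φ
  generator_differentiable : ∀ h ∈ H, ∀ x, DifferentiableAt ℝ φ (h x)
  model_measurable : ∀ h ∈ H, Measurable h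
  model_mem : ∀ h ∈ H, ∀ x, h x ∈ Ys
  conj_bound : ∀ h ∈ H, ∀ x, |h x * deriv φ (h x) - φ (h x)| ≤ m
  deriv_bound : ∀ h ∈ H, ∀ x, |deriv φ (h x)| ≤ M

/-- `hstar` minimizes the risk over `H`. -/
def IsRiskMinimizer (P : Measure (X × ℝ)) (φ : ℝ → ℝ) (H : Set (X → ℝ)) (hstar : X → ℝ) : Prop :=
  hstar ∈ H ∧ ∀ h ∈ H, risk P φ hstar ≤ risk P φ h

/-- A risk-approximation estimator: a measurable rule that sends (almost) every data set to a
minimizer of the empirical approximated risk over `H`. -/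
structure IsRAEstimator (P : Measure (X × ℝ)) (φ : ℝ → ℝ) (H : Set (X → ℝ)) (lam w₁ w₂ : ℝ)
    {nU nR : ℕ} (hhat : RAData X nU nR → X → ℝ) : Prop where
  mem : ∀ D, hhat D ∈ H
  measurable : Measurable fun q : RAData X nU nR × X => hhat q.1 q.2
  minimizes : ∀ᵐ D ∂dataLaw P nU nR, ∀ h ∈ H,
    empRisk P φ lam w₁ w₂ D (hhat D) ≤ empRisk P φ lam w₁ w₂ D h

end UncoupledRegression

end

namespace UncoupledRegression

/-! Expanding the Bregman divergence, only `E[Y φ'(h(X))]` couples target and feature. Since `Y` has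
no atoms, `E[g(X⁺)] = 2 E[F_Y(Y) g(X)]`, and `E[g(X⁺)] + E[g(X⁻)] = 2 E[g(X)]`. Comparison data
therefore estimate `E[(2 w₁ F_Y(Y) + 2 w₂ (1 - F_Y(Y))) φ'(h(X))]`, within `M * Err` of the coupling
term, and the `lam` terms cancel in expectation (`IsProblem.abs_approxRisk_sub_risk_le`). Comparing
the empirical minimizer with `hstar` costs this error twice, plus deviations of empirical means.

Those deviations must be `O(n^(-1/2))` with no `log n`, which calls for chaining. Everything is
carried by moments `E exp((x / scale)^2) ≤ e`. Dudley's packing argument gives nets of size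
`exp(O((d+1)^2 (j+1)))` at radius `n / 4^j`, and the links of the chain have summable scales
(`cubeMean_exp_radSum_indVec_sq_le`). A bounded real class reduces to its superlevel sets by
averaging over a uniform threshold. Symmetrization with a ghost sample transfers the moment to the
population (`integral_exp_deviation_sq_le`), and Markov's inequality gives the tail.

Suprema over the class need not be measurable, so every bound concerns one selected member: an
arbitrary function of the signs on the cube, a measurable rule of the data afterwards. -/

/-- The mean over the sign cube. -/
noncomputable def cubeMean {n : ℕ} (g : (Fin n → Bool) → ℝ) : ℝ := (∑ σ, g σ) / 2 ^ n

/-- The sign `±1` encoded by a Boolean. -/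
def sgn (b : Bool) : ℝ := if b then 1 else -1

/-- The Rademacher sum of the vector `a`. -/
noncomputable def radSum {n : ℕ} (σ : Fin n → Bool) (a : Fin n → ℝ) : ℝ := ∑ i, sgn (σ i) * a i

/-! ### Square-exponential moments of Rademacher sums -/

section Cube

variable {n : ℕ}

lemma cubeMean_mono {f g : (Fin n → Bool) → ℝ} (h : ∀ σ, f σ ≤ g σ) :
    cubeMean f ≤ cubeMean g := by
  unfold cubeMean
  gcongr with σ
  exact h σ

lemma cubeMean_const (c : ℝ) : cubeMean (fun _ : Fin n → Bool => c) = c := by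
  simp [cubeMean]

lemma cubeMean_mul_left (c : ℝ) (f : (Fin n → Bool) → ℝ) :
    cubeMean (fun σ => c * f σ) = c * cubeMean f := by
  simp [cubeMean, ← Finset.mul_sum, mul_div_assoc]

lemma cubeMean_sum {ι : Type*} (s : Finset ι) (f : ι → (Fin n → Bool) → ℝ) :
    cubeMean (fun σ => ∑ j ∈ s, f j σ) = ∑ j ∈ s, cubeMean (f j) := by
  simp only [cubeMean, ← Finset.sum_div]
  rw [Finset.sum_comm]

lemma cubeMean_integral {α : Type*} [MeasurableSpace α] {μ : Measure α}
    {f : α → (Fin n → Bool) → ℝ} (hf : ∀ σ, Integrable (fun x => f x σ) μ) :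
    cubeMean (fun σ => ∫ x, f x σ ∂μ) = ∫ x, cubeMean (f x) ∂μ := by
  simp only [cubeMean]
  rw [integral_div, integral_finsetSum _ fun σ _ => hf σ]

lemma cubeMean_pow_le (f : (Fin n → Bool) → ℝ) (hf : ∀ σ, 0 ≤ f σ) (p : ℕ) :
    cubeMean f ^ p ≤ cubeMean fun σ => f σ ^ p := by
  have h := Real.pow_arith_mean_le_arith_mean_pow Finset.univ
    (fun _ : Fin n → Bool => ((2 : ℝ) ^ n)⁻¹) f (fun _ _ => by positivity) (by simp)
    (fun σ _ => hf σ) p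
  simp only [← Finset.mul_sum] at h
  simpa [cubeMean, div_eq_inv_mul] using h

/-- Independence of the signs turns the mean into `∏ cosh (a i)`, and `cosh x ≤ exp (x² / 2)`. -/
lemma cubeMean_exp_radSum_le (a : Fin n → ℝ) :
    cubeMean (fun σ => Real.exp (radSum σ a)) ≤ Real.exp ((∑ i, a i ^ 2) / 2) := by
  have h : ∑ σ : Fin n → Bool, Real.exp (radSum σ a) = ∏ i, (2 * Real.cosh (a i)) := by
    have h2 : ∀ i, 2 * Real.cosh (a i) = ∑ b : Bool, Real.exp (sgn b * a i) := by
      intro i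
      rw [Real.cosh_eq]
      simp [sgn]
      ring
    simp only [h2]
    rw [Finset.prod_univ_sum, Fintype.piFinset_univ]
    refine Finset.sum_congr rfl fun σ _ => ?_
    rw [radSum, Real.exp_sum]
  rw [cubeMean, h, Finset.prod_mul_distrib, Finset.prod_const, Finset.card_univ, Fintype.card_fin,
    mul_div_cancel_left₀ _ (by positivity), Finset.sum_div, Real.exp_sum]
  exact Finset.prod_le_prod (fun i _ => (Real.cosh_pos _).le) fun i _ =>
    Real.cosh_le_exp_half_sq _

lemma radSum_const_mul (c : ℝ) (σ : Fin n → Bool) (a : Fin n → ℝ) :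
    radSum σ (fun i => c * a i) = c * radSum σ a := by
  simp only [radSum, Finset.mul_sum]
  exact Finset.sum_congr rfl fun i _ => by ring

lemma integrable_exp_mul_sub_sq (u : ℝ) :
    Integrable fun x : ℝ => Real.exp (u * x - x ^ 2 / 2) := by
  have h := ((integrable_exp_neg_mul_sq (b := 1 / 2) (by norm_num)).comp_sub_right u).const_mul
    (Real.exp (u ^ 2 / 2))
  refine h.congr (Eventually.of_forall fun x => ?_)
  simp only [← Real.exp_add]
  congr 1
  ring

/-- Completing the square. Read backwards, it linearizes `exp (u² / 2)` into a Gaussian average of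
exponentials linear in `u`. -/
lemma integral_exp_mul_sub_sq (u : ℝ) :
    ∫ x : ℝ, Real.exp (u * x - x ^ 2 / 2) = Real.exp (u ^ 2 / 2) * √(2 * Real.pi) := by
  have h : ∀ x : ℝ, Real.exp (u * x - x ^ 2 / 2)
      = Real.exp (u ^ 2 / 2) * Real.exp (-(1 / 2) * (x - u) ^ 2) := by
    intro x
    rw [← Real.exp_add]
    congr 1
    ring
  simp_rw [h]
  rw [integral_const_mul, integral_sub_right_eq_self (fun x : ℝ => Real.exp (-(1 / 2) * x ^ 2)) u,
    integral_gaussian]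
  congr 2
  ring

/-- A Rademacher sum has a sub-Gaussian square-exponential moment. -/
lemma cubeMean_exp_radSum_sq_le {V : ℝ} (hV : 0 < V) (a : Fin n → ℝ) (ha : ∑ i, a i ^ 2 ≤ V) :
    cubeMean (fun σ => Real.exp (radSum σ a ^ 2 / (4 * V))) ≤ 2 := by
  have hs : 0 < √(2 * Real.pi) := by positivity
  have hv : (√(2 * V)) ^ 2 = 2 * V := Real.sq_sqrt (by positivity)
  have hv0 : 0 < √(2 * V) := by positivity
  -- Write `exp (s² / (4V))` as a Gaussian average of `exp (s x / √(2V))`. The sign mean of the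
  -- latter is at most `exp (x² / 4)`, so `exp (-x² / 4)` remains under the integral; the resulting
  -- ratio `√(4π) / √(2π) = √2` is below `2`.
  have key : cubeMean (fun σ => Real.exp (radSum σ a ^ 2 / (4 * V))) * √(2 * Real.pi)
      ≤ √(4 * Real.pi) := by
    have h1 : cubeMean (fun σ => Real.exp (radSum σ a ^ 2 / (4 * V))) * √(2 * Real.pi)
        = cubeMean fun σ => ∫ x : ℝ, Real.exp (radSum σ a / √(2 * V) * x - x ^ 2 / 2) := by
      rw [mul_comm, ← cubeMean_mul_left]
      congr 1
      ext σ
      rw [integral_exp_mul_sub_sq, mul_comm, div_pow, hv]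
      congr 2
      field_simp
      norm_num
    rw [h1, cubeMean_integral (f := fun x σ =>
      Real.exp (radSum σ a / √(2 * V) * x - x ^ 2 / 2)) fun σ => integrable_exp_mul_sub_sq _]
    have h2 : ∫ x : ℝ, Real.exp (-(1 / 4) * x ^ 2) = √(4 * Real.pi) := by
      rw [integral_gaussian]
      congr 1
      ring
    rw [← h2]
    refine integral_mono ?_ (integrable_exp_neg_mul_sq (by norm_num)) fun x => ?_
    · simp only [cubeMean]
      exact (integrable_finsetSum _ fun σ _ => integrable_exp_mul_sub_sq _).div_const _
    · have h3 := cubeMean_exp_radSum_le fun i => x / √(2 * V) * a i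
      simp only [radSum_const_mul, mul_pow, ← Finset.mul_sum, div_pow, hv] at h3
      have h4 : (fun σ => Real.exp (radSum σ a / √(2 * V) * x - x ^ 2 / 2))
          = fun σ => Real.exp (-(x ^ 2 / 2)) * Real.exp (x / √(2 * V) * radSum σ a) := by
        ext σ
        rw [← Real.exp_add]
        congr 1
        ring
      simp only [h4, cubeMean_mul_left]
      calc Real.exp (-(x ^ 2 / 2)) * cubeMean (fun σ => Real.exp (x / √(2 * V) * radSum σ a))
          ≤ Real.exp (-(x ^ 2 / 2)) * Real.exp (x ^ 2 / (2 * V) * V / 2) := by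
            gcongr
            refine h3.trans ?_
            gcongr
        _ = Real.exp (-(1 / 4) * x ^ 2) := by
            rw [← Real.exp_add]
            congr 1
            field_simp
            ring
  have h5 : √(4 * Real.pi) ≤ 2 * √(2 * Real.pi) := by
    rw [Real.sqrt_le_left (by positivity), mul_pow, Real.sq_sqrt (by positivity)]
    nlinarith [Real.pi_pos]
  exact le_of_mul_le_mul_right (key.trans h5) hs

/-- Square-exponential moment of the maximum of a finite family of Rademacher sums, in the form of
a bound for every sign-dependent selection from the family. -/
lemma cubeMean_exp_radSum_selection_le {V : ℝ} (hV : 0 < V) (F : Finset (Fin n → ℝ))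
    (hF : ∀ a ∈ F, ∑ i, a i ^ 2 ≤ V) {p : ℕ} (hp : 0 < p) (hcard : 2 * (F.card : ℝ) ≤ Real.exp p)
    (l : (Fin n → Bool) → Fin n → ℝ) (hl : ∀ σ, l σ ∈ F) :
    cubeMean (fun σ => Real.exp (radSum σ (l σ) ^ 2 / (4 * V * p))) ≤ Real.exp 1 := by
  have hp' : (0 : ℝ) < p := by exact_mod_cast hp
  -- Jensen moves the `p`-th power inside, where it cancels the `p` of the exponent. The selected
  -- term is at most the sum over `F`, which is at most `exp p`; the `p`-th root brings this down to
  -- `e`.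
  refine le_of_pow_le_pow_left₀ hp.ne' (Real.exp_pos _).le ?_
  calc cubeMean (fun σ => Real.exp (radSum σ (l σ) ^ 2 / (4 * V * p))) ^ p
      ≤ cubeMean (fun σ => Real.exp (radSum σ (l σ) ^ 2 / (4 * V * p)) ^ p) :=
        cubeMean_pow_le _ (fun σ => (Real.exp_pos _).le) p
    _ = cubeMean (fun σ => Real.exp (radSum σ (l σ) ^ 2 / (4 * V))) := by
        congr 1
        ext σ
        rw [← Real.exp_nat_mul]
        congr 1
        field_simp
    _ ≤ cubeMean (fun σ => ∑ a ∈ F, Real.exp (radSum σ a ^ 2 / (4 * V))) :=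
        cubeMean_mono fun σ => Finset.single_le_sum
          (f := fun a => Real.exp (radSum σ a ^ 2 / (4 * V)))
          (fun a _ => (Real.exp_pos _).le) (hl σ)
    _ = ∑ a ∈ F, cubeMean (fun σ => Real.exp (radSum σ a ^ 2 / (4 * V))) := cubeMean_sum _ _
    _ ≤ ∑ _a ∈ F, (2 : ℝ) := Finset.sum_le_sum fun a ha =>
        cubeMean_exp_radSum_sq_le hV a (hF a ha)
    _ = 2 * (F.card : ℝ) := by rw [Finset.sum_const, nsmul_eq_mul, mul_comm]
    _ ≤ Real.exp p := hcard
    _ = Real.exp 1 ^ p := by rw [← Real.exp_nat_mul, mul_one]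

lemma convexOn_exp_mul_sq {c : ℝ} (hc : 0 ≤ c) :
    ConvexOn ℝ Set.univ fun x : ℝ => Real.exp (c * x ^ 2) := by
  refine ⟨convex_univ, fun x _ y _ a b ha hb hab => ?_⟩
  have h1 : (a * x + b * y) ^ 2 ≤ a * x ^ 2 + b * y ^ 2 := by
    have : 0 ≤ a * b * (x - y) ^ 2 := by positivity
    obtain rfl : b = 1 - a := by linarith
    nlinarith
  refine le_trans ?_ (convexOn_exp.2 (Set.mem_univ (c * x ^ 2)) (Set.mem_univ (c * y ^ 2))
    ha hb hab)
  simp only [smul_eq_mul]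
  refine Real.exp_le_exp.2 ?_
  nlinarith [mul_le_mul_of_nonneg_left h1 hc]

/-- A sum of terms with controlled square-exponential moments is controlled at the sum of the
scales. -/
lemma cubeMean_exp_sum_sq_le {J : ℕ} (hJ : 0 < J) (b : ℕ → ℝ) (hb : ∀ j, 0 < b j)
    (x : ℕ → (Fin n → Bool) → ℝ) {K : ℝ}
    (hx : ∀ j, j < J → cubeMean (fun σ => Real.exp ((x j σ / b j) ^ 2)) ≤ K)
    {B : ℝ} (hB : ∑ j ∈ Finset.range J, b j ≤ B) :
    cubeMean (fun σ => Real.exp (((∑ j ∈ Finset.range J, x j σ) / B) ^ 2)) ≤ K := by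
  set b' := ∑ j ∈ Finset.range J, b j
  have hb' : 0 < b' := Finset.sum_pos (fun j _ => hb j) ⟨0, Finset.mem_range.2 hJ⟩
  have hw : ∑ j ∈ Finset.range J, b j / b' = 1 := by
    rw [← Finset.sum_div]
    exact div_self hb'.ne'
  calc cubeMean (fun σ => Real.exp (((∑ j ∈ Finset.range J, x j σ) / B) ^ 2))
      ≤ cubeMean (fun σ => ∑ j ∈ Finset.range J, b j / b' * Real.exp ((x j σ / b j) ^ 2)) := by
        refine cubeMean_mono fun σ => ?_
        calc Real.exp (((∑ j ∈ Finset.range J, x j σ) / B) ^ 2)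
            ≤ Real.exp (((∑ j ∈ Finset.range J, x j σ) / b') ^ 2) := by
              simp only [div_pow]
              gcongr
          -- The normalized sum is a convex combination of the `x j / b j` with weights `b j / b'`.
          _ = Real.exp (1 * (∑ j ∈ Finset.range J, (b j / b') • (x j σ / b j)) ^ 2) := by
              rw [one_mul, Finset.sum_div]
              congr 2
              refine Finset.sum_congr rfl fun j _ => ?_
              have := (hb j).ne'
              rw [smul_eq_mul]
              field_simp
          _ ≤ ∑ j ∈ Finset.range J, (b j / b') • Real.exp (1 * (x j σ / b j) ^ 2) :=
              (convexOn_exp_mul_sq zero_le_one).map_sum_le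
                (fun j _ => (div_pos (hb j) hb').le) hw fun _ _ => Set.mem_univ _
          _ = _ := by simp
    _ = ∑ j ∈ Finset.range J, b j / b' * cubeMean (fun σ => Real.exp ((x j σ / b j) ^ 2)) := by
        rw [cubeMean_sum]
        exact Finset.sum_congr rfl fun j _ => cubeMean_mul_left _ _
    _ ≤ ∑ j ∈ Finset.range J, b j / b' * K := by
        refine Finset.sum_le_sum fun j hj => ?_
        have := hb j
        gcongr
        exact hx j (Finset.mem_range.1 hj)
    _ = K := by rw [← Finset.sum_mul, hw, one_mul]

end Cube

/-! ### Sauer-Shelah and Dudley's packing bound -/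

section Packing

open Finset
open scoped symmDiff

lemma sum_choose_le_pow (k d : ℕ) : ∑ i ∈ range (d + 1), k.choose i ≤ (k + 1) ^ d := by
  induction d with
  | zero => simp
  | succ d ih =>
    rw [sum_range_succ, pow_succ]
    have h1 : k.choose (d + 1) ≤ k * (k + 1) ^ d := by
      refine (Nat.choose_le_pow _ _).trans ?_
      rw [pow_succ, mul_comm]
      gcongr
      omega
    nlinarith

/-- The **Sauer-Shelah lemma** in polynomial form. -/
lemma card_le_pow_of_shatters {k d : ℕ} (𝒜 : Finset (Finset (Fin k)))
    (h : ∀ s, 𝒜.Shatters s → s.card ≤ d) : 𝒜.card ≤ (k + 1) ^ d := by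
  have hd : 𝒜.vcDim ≤ d := Finset.sup_le fun s hs => h s (mem_shatterer.1 hs)
  refine (card_le_card_shatterer 𝒜).trans (card_shatterer_le_sum_vcDim.trans ?_)
  rw [Fintype.card_fin]
  refine le_trans ?_ (sum_choose_le_pow k d)
  refine sum_le_sum_of_subset fun i hi => ?_
  simp only [mem_Iic, mem_range] at hi ⊢
  omega

/-- Sampling with repetition cannot raise the VC dimension: cutting out singletons of a shattered
`s` forces `ω` to be injective on `s`, so the traces live on a shattered set of the same size. -/
lemma shatters_of_shatters_image_preimage {α β : Type*} [DecidableEq α] [DecidableEq β]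
    [Fintype α] (ω : α → β) (𝒜 : Finset (Finset β)) {s : Finset α}
    (h : (𝒜.image fun A => univ.filter fun i => ω i ∈ A).Shatters s) :
    𝒜.Shatters (s.image ω) ∧ (s.image ω).card = s.card := by
  have h' : ∀ t ⊆ s, ∃ A ∈ 𝒜, ∀ i ∈ s, ω i ∈ A ↔ i ∈ t := by
    intro t ht
    obtain ⟨u, hu, hut⟩ := h ht
    obtain ⟨A, hA, rfl⟩ := mem_image.1 hu
    refine ⟨A, hA, fun i hi => ?_⟩
    rw [← hut]
    simp [hi]
  refine ⟨fun t ht => ?_, card_image_of_injOn fun i hi j hj hij => ?_⟩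
  · obtain ⟨A, hA, hAt⟩ := h' (s.filter fun i => ω i ∈ t) (filter_subset _ _)
    refine ⟨A, hA, ?_⟩
    ext b
    simp only [mem_inter, mem_image]
    constructor
    · rintro ⟨⟨i, hi, rfl⟩, hb⟩
      exact (mem_filter.1 ((hAt i hi).1 hb)).2
    · intro hb
      obtain ⟨i, hi, rfl⟩ := mem_image.1 (ht hb)
      exact ⟨⟨i, hi, rfl⟩, (hAt i hi).2 (mem_filter.2 ⟨hi, hb⟩)⟩
  · obtain ⟨A, hA, hAt⟩ := h' {i} (by simpa using hi)
    have h1 := hAt i hi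
    have h2 := hAt j hj
    rw [← hij, h1] at h2
    simpa [eq_comm] using h2

/-- **Dudley's packing argument**: a separated family is not collapsed by restriction to a random
sample, so that its size obeys the Sauer-Shelah bound of the sample. -/
lemma card_le_of_separated {n d k : ℕ} (hn : 0 < n) (T : Finset (Finset (Fin n)))
    (hVC : ∀ s, T.Shatters s → s.card ≤ d) {ε : ℝ}
    (hsep : ∀ A ∈ T, ∀ B ∈ T, A ≠ B → ε * n < ((A ∆ B).card : ℝ))
    (hk : (T.card : ℝ) ^ 2 * Real.exp (-(ε * k)) < 1) : T.card ≤ (k + 1) ^ d := by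
  have hn' : (0 : ℝ) < n := by exact_mod_cast hn
  -- The probabilistic method by counting: at most a fraction `(1 - ε)^k ≤ exp (-ε k)` of the
  -- samples misses a given `A ∆ B`, and there are at most `|T|²` pairs.
  obtain ⟨ω, hω⟩ : ∃ ω : Fin k → Fin n, ∀ A ∈ T, ∀ B ∈ T, A ≠ B → ∃ i, ω i ∈ A ∆ B := by
    by_contra! hcon
    have hcover : (univ : Finset (Fin k → Fin n)) ⊆
        T.offDiag.biUnion fun q => Fintype.piFinset fun _ => (q.1 ∆ q.2)ᶜ := by
      intro ω _
      obtain ⟨A, hA, B, hB, hAB, h⟩ := hcon ω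
      refine mem_biUnion.2 ⟨(A, B), mem_offDiag.2 ⟨hA, hB, hAB⟩, ?_⟩
      exact Fintype.mem_piFinset.2 fun i => mem_compl.2 (h i)
    have h1 := (card_le_card hcover).trans card_biUnion_le
    rw [card_univ, Fintype.card_fun, Fintype.card_fin, Fintype.card_fin] at h1
    have h2 : ∀ q ∈ T.offDiag,
        ((Fintype.piFinset fun _ : Fin k => (q.1 ∆ q.2)ᶜ).card : ℝ)
          ≤ (n : ℝ) ^ k * Real.exp (-(ε * k)) := by
      intro q hq
      obtain ⟨hA, hB, hAB⟩ := mem_offDiag.1 hq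
      have hs := hsep _ hA _ hB hAB
      rw [Fintype.card_piFinset, prod_const, card_univ, Fintype.card_fin, card_compl,
        Fintype.card_fin, Nat.cast_pow, Nat.cast_sub (by simpa using card_le_univ (q.1 ∆ q.2)),
        show -(ε * (k : ℝ)) = k * (-ε) by ring, Real.exp_nat_mul, ← mul_pow]
      have h3 : ((q.1 ∆ q.2).card : ℝ) ≤ n := by
        exact_mod_cast (by simpa using card_le_univ (q.1 ∆ q.2))
      refine pow_le_pow_left₀ (by linarith) ?_ k
      nlinarith [Real.add_one_le_exp (-ε)]
    have h4 : (n : ℝ) ^ k ≤ (T.card : ℝ) ^ 2 * ((n : ℝ) ^ k * Real.exp (-(ε * k))) := by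
      calc (n : ℝ) ^ k ≤ ∑ q ∈ T.offDiag,
            ((Fintype.piFinset fun _ : Fin k => (q.1 ∆ q.2)ᶜ).card : ℝ) := by exact_mod_cast h1
        _ ≤ ∑ _q ∈ T.offDiag, (n : ℝ) ^ k * Real.exp (-(ε * k)) := sum_le_sum h2
        _ = T.offDiag.card * ((n : ℝ) ^ k * Real.exp (-(ε * k))) := by
            rw [sum_const, nsmul_eq_mul]
        _ ≤ _ := by
            gcongr
            rw [offDiag_card, sq]
            exact_mod_cast Nat.sub_le _ _
    have h5 : (0 : ℝ) < (n : ℝ) ^ k := by positivity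
    nlinarith
  -- A sample hitting every symmetric difference keeps the traces of distinct members distinct.
  have hinj : Set.InjOn (fun A : Finset (Fin n) => univ.filter fun i => ω i ∈ A) T := by
    intro A hA B hB hAB
    by_contra hne
    obtain ⟨i, hi⟩ := hω A hA B hB hne
    have h1 : ω i ∈ A ↔ ω i ∈ B := by
      have := Finset.ext_iff.1 hAB i
      simpa using this
    rw [mem_symmDiff] at hi
    tauto
  rw [← card_image_of_injOn hinj]
  refine card_le_pow_of_shatters _ fun s hs => ?_
  obtain ⟨h1, h2⟩ := shatters_of_shatters_image_preimage ω T hs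
  exact h2 ▸ hVC _ h1

end Packing

end UncoupledRegression

namespace UncoupledRegression

/-! ### Chaining over set classes -/

section Chaining

open Finset
open scoped symmDiff

variable {n : ℕ}

/-- The packing bound with sample size `k` of order `4^j log |T|` reads `log |T| ≤ d log (k + 1)`,
an inequality with `log |T|` on both sides, to be solved. -/
lemma card_le_exp_of_separated {d : ℕ} (hn : 0 < n) (T : Finset (Finset (Fin n)))
    (hVC : ∀ s, T.Shatters s → s.card ≤ d) (j : ℕ)
    (hsep : ∀ A ∈ T, ∀ B ∈ T, A ≠ B → (n : ℝ) / 4 ^ j < ((A ∆ B).card : ℝ)) :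
    (T.card : ℝ) ≤ Real.exp ((8 * (d + 1) ^ 2 * (j + 1) : ℕ)) := by
  rcases T.eq_empty_or_nonempty with rfl | hT
  · simp only [card_empty, Nat.cast_zero]
    positivity
  have hN : (1 : ℝ) ≤ T.card := by exact_mod_cast hT.card_pos
  set L := Real.log T.card with hL
  have hL0 : 0 ≤ L := Real.log_nonneg hN
  have h4 : (1 : ℝ) ≤ 4 ^ j := one_le_pow₀ (by norm_num)
  -- The `2` pays for the squared cardinality in the packing condition; the `+ 1` makes that
  -- condition strict.
  set k := ⌊2 * 4 ^ j * L⌋₊ + 1 with hk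
  have hk1 : 2 * 4 ^ j * L < k := by
    rw [hk]
    exact_mod_cast Nat.lt_floor_add_one (2 * 4 ^ j * L)
  have hk2 : (k : ℝ) ≤ 2 * 4 ^ j * L + 1 := by
    rw [hk]
    push_cast
    gcongr
    exact Nat.floor_le (by positivity)
  have hcard := card_le_of_separated (k := k) (ε := ((4 : ℝ) ^ j)⁻¹) hn T hVC
    (fun A hA B hB hAB => by
      rw [mul_comm, ← div_eq_mul_inv]
      exact hsep A hA B hB hAB) (by
      rw [← Real.exp_log (lt_of_lt_of_le one_pos hN), ← hL, ← Real.exp_nat_mul, ← Real.exp_add,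
        Real.exp_lt_one_iff]
      have : 2 * L < ((4 : ℝ) ^ j)⁻¹ * k := by
        rw [inv_mul_eq_div, lt_div_iff₀ (by positivity)]
        linarith
      push_cast
      linarith)
  have hlog : L ≤ d * Real.log (k + 1) := by
    rw [← Real.log_pow]
    refine Real.log_le_log (by linarith) ?_
    exact_mod_cast hcard
  -- Splitting off `4 (d + 1)` before applying `log x ≤ x - 1` makes the term in `L`, once
  -- multiplied by `d`, at most `(L + 1) / 2`, which the left side absorbs.
  have hlog2 : Real.log (k + 1) ≤ 2 * j + ((2 * L + 2) / (4 * (d + 1)) - 1 + 4 * (d + 1)) := by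
    have hpos : (0 : ℝ) < 4 * (d + 1) := by positivity
    have hlog4 : Real.log 4 ≤ 2 := by
      rw [show (4 : ℝ) = 2 ^ 2 by norm_num, Real.log_pow]
      have := Real.log_two_lt_d9
      push_cast
      linarith
    calc Real.log (k + 1) ≤ Real.log (4 ^ j * (2 * L + 2)) := by
          refine Real.log_le_log (by positivity) ?_
          nlinarith
      _ = j * Real.log 4 + Real.log ((2 * L + 2) / (4 * (d + 1)) * (4 * (d + 1))) := by
          rw [Real.log_mul (by positivity) (by positivity), Real.log_pow,
            div_mul_cancel₀ _ hpos.ne']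
      _ = j * Real.log 4 + (Real.log ((2 * L + 2) / (4 * (d + 1))) + Real.log (4 * (d + 1))) := by
          rw [Real.log_mul (by positivity) (by positivity)]
      _ ≤ j * 2 + (((2 * L + 2) / (4 * (d + 1)) - 1) + 4 * (d + 1)) := by
          gcongr
          · exact Real.log_le_sub_one_of_pos (by positivity)
          · exact (Real.log_le_sub_one_of_pos hpos).trans (by linarith)
      _ = _ := by ring
  have hd : (d : ℝ) * ((2 * L + 2) / (4 * (d + 1))) ≤ (L + 1) / 2 := by
    rw [← mul_div_assoc, div_le_div_iff₀ (by positivity) (by norm_num)]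
    nlinarith
  have hfin : L ≤ (8 * (d + 1) ^ 2 * (j + 1) : ℕ) := by
    have h1 := hlog.trans (mul_le_mul_of_nonneg_left hlog2 (Nat.cast_nonneg d))
    push_cast
    have hd0 : (0 : ℝ) ≤ d := Nat.cast_nonneg d
    have hj0 : (0 : ℝ) ≤ j := Nat.cast_nonneg j
    have hdj : (0 : ℝ) ≤ d * j := by positivity
    have hddj : (0 : ℝ) ≤ d * d * j := by positivity
    nlinarith
  rw [← Real.exp_log (lt_of_lt_of_le one_pos hN)]
  exact Real.exp_le_exp.2 hfin

/-- Greedy choice: a set is added only if it is far from all those chosen. As the net lies inside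
`𝒞`, it inherits the VC bound. -/
lemma exists_separated_net (𝒞 : Finset (Finset (Fin n))) (δ : ℝ) (hδ : 0 ≤ δ) :
    ∃ T ⊆ 𝒞, (∀ A ∈ T, ∀ B ∈ T, A ≠ B → δ < ((A ∆ B).card : ℝ)) ∧
      ∀ A ∈ 𝒞, ∃ B ∈ T, ((A ∆ B).card : ℝ) ≤ δ := by
  induction 𝒞 using Finset.induction_on with
  | empty => exact ⟨∅, by simp, by simp, by simp⟩
  | insert A 𝒞 _ ih =>
    obtain ⟨T, hT, hsep, hcov⟩ := ih
    by_cases h : ∃ B ∈ T, ((A ∆ B).card : ℝ) ≤ δ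
    · refine ⟨T, hT.trans (subset_insert _ _), hsep, fun A' hA' => ?_⟩
      rcases mem_insert.1 hA' with rfl | hA'
      · exact h
      · exact hcov A' hA'
    · push Not at h
      refine ⟨insert A T, insert_subset_insert _ hT, ?_, ?_⟩
      · intro A₁ h₁ A₂ h₂ hne
        rcases mem_insert.1 h₁ with h₁' | h₁' <;> rcases mem_insert.1 h₂ with h₂' | h₂'
        · exact absurd (h₁'.trans h₂'.symm) hne
        · exact h₁' ▸ h _ h₂'
        · rw [symmDiff_comm, h₂']
          exact h _ h₁'
        · exact hsep _ h₁' _ h₂' hne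
      · intro A' hA'
        rcases mem_insert.1 hA' with rfl | hA'
        · exact ⟨A', mem_insert_self _ _, by simpa using hδ⟩
        · obtain ⟨B, hB, hAB⟩ := hcov A' hA'
          exact ⟨B, mem_insert_of_mem hB, hAB⟩

lemma exists_net {d : ℕ} (hn : 0 < n) (𝒞 : Finset (Finset (Fin n)))
    (hVC : ∀ s, 𝒞.Shatters s → s.card ≤ d) (j : ℕ) :
    ∃ π : Finset (Fin n) → Finset (Fin n),
      (∀ A ∈ 𝒞, ((A ∆ π A).card : ℝ) ≤ n / 4 ^ j) ∧
      ((𝒞.image π).card : ℝ) ≤ Real.exp ((8 * (d + 1) ^ 2 * (j + 1) : ℕ)) := by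
  obtain ⟨T, hT, hsep, hcov⟩ := exists_separated_net 𝒞 ((n : ℝ) / 4 ^ j) (by positivity)
  choose! π hπ using hcov
  refine ⟨π, fun A hA => (hπ A hA).2, ?_⟩
  refine le_trans ?_ (card_le_exp_of_separated hn T
    (fun s hs => hVC s (hs.mono_left hT)) j hsep)
  exact_mod_cast card_le_card (image_subset_iff.2 fun A hA => (hπ A hA).1)

/-- The `0`-`1` vector of a set of coordinates. -/
def indVec (A : Finset (Fin n)) (i : Fin n) : ℝ := if i ∈ A then 1 else 0

lemma sum_indVec_sub_sq (A B : Finset (Fin n)) :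
    ∑ i, (indVec A i - indVec B i) ^ 2 = ((A ∆ B).card : ℝ) := by
  have h : ∀ i, (indVec A i - indVec B i) ^ 2 = if i ∈ A ∆ B then 1 else 0 := by
    intro i
    by_cases h₁ : i ∈ A <;> by_cases h₂ : i ∈ B <;> simp [indVec, mem_symmDiff, h₁, h₂]
  simp [h]

lemma sum_succ_div_two_pow_le (J : ℕ) : ∑ j ∈ range J, ((j : ℝ) + 1) / 2 ^ j ≤ 4 := by
  have h : ∑ j ∈ range J, ((j : ℝ) + 1) / 2 ^ j = 4 - (2 * J + 4) / 2 ^ J := by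
    induction J with
    | zero => norm_num
    | succ J ih =>
      rw [sum_range_succ, ih, pow_succ]
      push_cast
      field_simp
      ring
  rw [h]
  have : (0 : ℝ) ≤ (2 * J + 4) / 2 ^ J := by positivity
  linarith

/-- **Chaining.** The Rademacher sums over a set class of VC dimension at most `d` have a
square-exponential moment at scale `√n`, without a logarithmic factor. -/
lemma cubeMean_exp_radSum_indVec_sq_le {d : ℕ} (hn : 0 < n) (𝒞 : Finset (Finset (Fin n)))
    (hVC : ∀ s, 𝒞.Shatters s → s.card ≤ d) (A : (Fin n → Bool) → Finset (Fin n))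
    (hA : ∀ σ, A σ ∈ 𝒞) :
    cubeMean (fun σ => Real.exp ((radSum σ (indVec (A σ)) / (64 * (d + 1) * √n)) ^ 2))
      ≤ Real.exp 1 := by
  have hn' : (0 : ℝ) < n := by exact_mod_cast hn
  obtain ⟨π, hπ0, hπd, hπc⟩ : ∃ π : ℕ → Finset (Fin n) → Finset (Fin n),
      (∀ A, π 0 A = ∅) ∧ (∀ j, ∀ A ∈ 𝒞, ((A ∆ π j A).card : ℝ) ≤ n / 4 ^ j) ∧
      ∀ j, ((𝒞.image (π j)).card : ℝ) ≤ Real.exp ((8 * (d + 1) ^ 2 * (j + 1) : ℕ)) := by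
    choose π hπ using exists_net hn 𝒞 hVC
    -- Level `0` is replaced by the empty set, still within radius `n / 4^0 = n` of every set, so
    -- the chain starts from a vanishing Rademacher sum.
    refine ⟨fun j => if j = 0 then fun _ => ∅ else π j, by simp, fun j A hA => ?_, fun j => ?_⟩
    · by_cases hj : j = 0
      · subst hj
        have : A ∆ ∅ = A := symmDiff_bot A
        simpa [this] using card_le_univ A
      · simpa [hj] using (hπ j).1 A hA
    · by_cases hj : j = 0
      · subst hj
        simp only [if_true]
        calc ((𝒞.image fun _ => (∅ : Finset (Fin n))).card : ℝ) ≤ 1 := by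
              exact_mod_cast (card_le_card (image_subset_iff (t := {∅}).2 (by simp))).trans
                (by simp)
          _ ≤ _ := Real.one_le_exp (Nat.cast_nonneg _)
      · simpa [hj] using (hπ j).2
  let link : ℕ → Finset (Fin n) → Fin n → ℝ := fun j A i => indVec (π (j + 1) A) i - indVec (π j A) i
  have hlink : ∀ j, ∀ A ∈ 𝒞, ∑ i, link j A i ^ 2 ≤ 2 * n / 4 ^ j := by
    intro j A hA
    simp only [link]
    rw [sum_indVec_sub_sq]
    have h1 := hπd j A hA
    have h2 := hπd (j + 1) A hA
    have h3 : (π (j + 1) A ∆ π j A).card ≤ (A ∆ π (j + 1) A).card + (A ∆ π j A).card := by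
      refine le_trans (card_le_card ?_) (card_union_le _ _)
      rw [symmDiff_comm A (π (j + 1) A)]
      exact symmDiff_triangle _ _ _
    have h4 : (n : ℝ) / 4 ^ (j + 1) ≤ n / 4 ^ j := by
      gcongr
      · norm_num
      · omega
    have h5 : ((π (j + 1) A ∆ π j A).card : ℝ) ≤ (A ∆ π (j + 1) A).card + (A ∆ π j A).card := by
      exact_mod_cast h3
    rw [mul_div_assoc]
    linarith
  -- With `K = 8 (d + 1)²`, a link takes at most `exp (K (2j + 3))` values and the factor `2` is at
  -- most `e`; `4 K (j + 1)` covers both.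
  let p : ℕ → ℕ := fun j => 4 * (8 * (d + 1) ^ 2) * (j + 1)
  have hcard : ∀ j, 2 * ((𝒞.image (link j)).card : ℝ) ≤ Real.exp (p j) := by
    intro j
    have h1 : (𝒞.image (link j)).card ≤ (𝒞.image (π (j + 1))).card * (𝒞.image (π j)).card := by
      rw [← card_product]
      have h2 : 𝒞.image (link j) ⊆ ((𝒞.image (π (j + 1))) ×ˢ (𝒞.image (π j))).image
          fun q => fun i => indVec q.1 i - indVec q.2 i := by
        refine image_subset_iff.2 fun A hA => mem_image.2 ⟨(π (j + 1) A, π j A), ?_, rfl⟩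
        exact mem_product.2 ⟨mem_image_of_mem _ hA, mem_image_of_mem _ hA⟩
      exact (card_le_card h2).trans card_image_le
    have h2 : (2 : ℝ) ≤ Real.exp 1 := by
      have := Real.add_one_le_exp (1 : ℝ)
      linarith
    calc 2 * ((𝒞.image (link j)).card : ℝ)
        ≤ Real.exp 1 * (Real.exp ((8 * (d + 1) ^ 2 * (j + 1 + 1) : ℕ))
            * Real.exp ((8 * (d + 1) ^ 2 * (j + 1) : ℕ))) := by
          refine mul_le_mul h2 ?_ (by positivity) (by positivity)
          refine le_trans (b := ((𝒞.image (π (j + 1))).card * (𝒞.image (π j)).card : ℝ))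
            (by exact_mod_cast h1) ?_
          exact mul_le_mul (hπc (j + 1)) (hπc j) (by positivity) (by positivity)
      _ ≤ Real.exp (p j) := by
          rw [← Real.exp_add, ← Real.exp_add, Real.exp_le_exp]
          simp only [p]
          have : 1 ≤ 8 * (d + 1) ^ 2 := Nat.one_le_iff_ne_zero.2 (by positivity)
          norm_cast
          generalize 8 * (d + 1) ^ 2 = K at *
          nlinarith
  -- The moment bound needs scale `√(4 V p) = 16 (d + 1) √n √(j + 1) / 2^j`; enlarging `√(j + 1)` to
  -- `j + 1` gives a series with a closed form, of sum at most `4`, whence `64`.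
  have hstep : ∀ j, j < n → cubeMean (fun σ => Real.exp
      ((radSum σ (link j (A σ)) / (16 * (d + 1) * √n * ((j + 1) / 2 ^ j))) ^ 2)) ≤ Real.exp 1 := by
    intro j _
    have h := cubeMean_exp_radSum_selection_le (V := 2 * n / 4 ^ j) (by positivity)
      (𝒞.image (link j)) (fun a ha => by
        obtain ⟨A, hA, rfl⟩ := mem_image.1 ha
        exact hlink j A hA) (p := p j) (by positivity) (hcard j) (fun σ => link j (A σ))
      (fun σ => mem_image_of_mem _ (hA σ))
    refine (cubeMean_mono fun σ => Real.exp_le_exp.2 ?_).trans h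
    rw [div_pow]
    refine div_le_div_of_nonneg_left (sq_nonneg _) (by positivity) ?_
    have hsq : (√(n : ℝ)) ^ 2 = n := Real.sq_sqrt hn'.le
    have h2 : ((2 : ℝ) ^ j) ^ 2 = 4 ^ j := by
      rw [← pow_mul, mul_comm, pow_mul]
      norm_num
    rw [mul_pow, mul_pow, mul_pow, div_pow, hsq, h2]
    simp only [p]
    push_cast
    rw [show 4 * (2 * (n : ℝ) / 4 ^ j) * (4 * (8 * (d + 1) ^ 2) * (j + 1))
        = 256 * (d + 1) ^ 2 * n * (j + 1) / 4 ^ j by ring,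
      show (16 : ℝ) ^ 2 * (d + 1) ^ 2 * n * ((j + 1) ^ 2 / 4 ^ j)
        = 256 * (d + 1) ^ 2 * n * (j + 1) ^ 2 / 4 ^ j by ring]
    gcongr
    nlinarith [(Nat.cast_nonneg j : (0 : ℝ) ≤ j)]
  have hsum := cubeMean_exp_sum_sq_le hn
    (fun j => 16 * (d + 1) * √n * ((j + 1) / 2 ^ j)) (fun j => by positivity)
    (fun j σ => radSum σ (link j (A σ))) hstep (B := 64 * (d + 1) * √n) (by
      rw [← mul_sum]
      have := mul_le_mul_of_nonneg_left (sum_succ_div_two_pow_le n)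
        (show (0 : ℝ) ≤ 16 * (d + 1) * √n by positivity)
      linarith)
  refine le_of_eq_of_le ?_ hsum
  congr 1
  ext σ
  congr 3
  -- At level `n` the radius `n / 4^n` is below `1`, so the net point is the set itself and the
  -- chain is finite.
  have hend : π n (A σ) = A σ := by
    have h1 := hπd n _ (hA σ)
    have h2 : (n : ℝ) / 4 ^ n < 1 := by
      rw [div_lt_one (by positivity)]
      exact_mod_cast Nat.lt_pow_self (by norm_num)
    have h3 : (A σ ∆ π n (A σ)).card = 0 := by
      have : ((A σ ∆ π n (A σ)).card : ℝ) < 1 := h1.trans_lt h2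
      exact Nat.lt_one_iff.1 (by exact_mod_cast this)
    rw [card_eq_zero, ← bot_eq_empty, symmDiff_eq_bot] at h3
    exact h3.symm
  have htel : ∑ j ∈ range n, radSum σ (link j (A σ))
      = ∑ j ∈ range n, (radSum σ (indVec (π (j + 1) (A σ))) - radSum σ (indVec (π j (A σ)))) := by
    refine sum_congr rfl fun j _ => ?_
    simp only [radSum, link, mul_sub, sum_sub_distrib]
  rw [htel, sum_range_sub (fun j => radSum σ (indVec (π j (A σ)))), hend, hπ0]
  simp [radSum, indVec]

end Chaining

end UncoupledRegression

namespace UncoupledRegression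

/-! ### From superlevel sets to bounded real classes -/

section RealClasses

/-- Jensen's inequality for `x ↦ exp (c x ^ 2)`. -/
lemma exp_mul_sq_integral_le {α : Type*} [MeasurableSpace α] {ρ : Measure α}
    [IsProbabilityMeasure ρ] {G : α → ℝ} (hG : Measurable G) {C : ℝ} (hC : ∀ a, |G a| ≤ C)
    {c : ℝ} (hc : 0 ≤ c) :
    Integrable (fun a => Real.exp (c * G a ^ 2)) ρ ∧
      Real.exp (c * (∫ a, G a ∂ρ) ^ 2) ≤ ∫ a, Real.exp (c * G a ^ 2) ∂ρ := by
  have h1 : Integrable (fun a => Real.exp (c * G a ^ 2)) ρ := by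
    refine Integrable.of_bound (by fun_prop) (Real.exp (c * C ^ 2)) (.of_forall fun a => ?_)
    rw [Real.norm_eq_abs, Real.abs_exp, Real.exp_le_exp]
    have := sq_le_sq' (neg_le_of_abs_le (hC a)) (le_of_abs_le (hC a))
    gcongr
  refine ⟨h1, (convexOn_exp_mul_sq hc).map_integral_le (by fun_prop) isClosed_univ
    (by simp) ?_ h1⟩
  exact Integrable.of_bound hG.aestronglyMeasurable C (.of_forall hC)

variable {X : Type u} {n : ℕ}

lemma card_le_of_pseudoDim_le {F : Set (X → ℝ)} {d : ℕ} (h : pseudoDim F ≤ d) (S : Finset X)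
    (hS : PseudoShatters F S) : S.card ≤ d := by
  have h1 : (S.card : ℕ∞) ≤ pseudoDim F := le_iSup₂_of_le S hS le_rfl
  exact_mod_cast h1.trans h

open Finset in
/-- The superlevel sets of the members of a class, seen at finitely many points, shatter only sets
of size at most the pseudo-dimension. -/
lemma card_le_of_shatters_superlevel {F : Set (X → ℝ)} {d : ℕ} (hF : pseudoDim F ≤ d)
    (x : Fin n → X) (r : ℝ) (𝒞 : Finset (Finset (Fin n)))
    (h𝒞 : ∀ A ∈ 𝒞, ∃ f ∈ F, ∀ i, i ∈ A ↔ r < f (x i)) (s : Finset (Fin n))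
    (hs : 𝒞.Shatters s) : s.card ≤ d := by
  classical
  have h' : ∀ t ⊆ s, ∃ f ∈ F, ∀ i ∈ s, r < f (x i) ↔ i ∈ t := by
    intro t ht
    obtain ⟨A, hA, rfl⟩ := hs ht
    obtain ⟨f, hf, hfA⟩ := h𝒞 A hA
    exact ⟨f, hf, fun i hi => by simp [← hfA, hi]⟩
  have hinj : Set.InjOn x s := by
    intro i hi j hj hij
    obtain ⟨f, -, hf⟩ := h' {i} (by simpa using hi)
    have h1 := hf i hi
    have h2 := hf j hj
    rw [← hij, h1] at h2
    simpa [eq_comm] using h2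
  rw [← card_image_of_injOn hinj]
  -- Pseudo-shattering allows a threshold for each point; the constant `r` is one such choice.
  refine card_le_of_pseudoDim_le hF _ ⟨fun _ => r, fun T hT => ?_⟩
  obtain ⟨f, hf, hft⟩ := h' (s.filter fun i => x i ∈ T) (filter_subset _ _)
  refine ⟨f, hf, fun y hy => ?_⟩
  obtain ⟨i, hi, rfl⟩ := mem_image.1 hy
  rw [hft i hi]
  simp [show i ∈ s from hi]

/-- The indicator of `r < v`. -/
noncomputable def above (r v : ℝ) : ℝ := if r < v then 1 else 0

lemma above_abs_le (r v : ℝ) : |above r v| ≤ 1 := by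
  unfold above
  split_ifs <;> simp

lemma measurable_above (v : ℝ) : Measurable fun r => above r v :=
  Measurable.ite measurableSet_Iio measurable_const measurable_const

/-- The two samples are chained separately and their scales `64 + 64` added. Only the finitely many
members selected by the signs matter, so the set class is finite. -/
lemma cubeMean_exp_above_sq_le {F : Set (X → ℝ)} {d : ℕ} (hF : pseudoDim F ≤ d) (hn : 0 < n)
    (x x' : Fin n → X) (f : (Fin n → Bool) → X → ℝ) (hf : ∀ σ, f σ ∈ F) (r : ℝ) :
    cubeMean (fun σ => Real.exp ((radSum σ
      (fun i => above r (f σ (x' i)) - above r (f σ (x i))) / (128 * (d + 1) * √n)) ^ 2))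
      ≤ Real.exp 1 := by
  classical
  have hn' : (0 : ℝ) < n := by exact_mod_cast hn
  have key : ∀ y : Fin n → X, cubeMean (fun σ => Real.exp ((radSum σ
      (fun i => above r (f σ (y i))) / (64 * (d + 1) * √n)) ^ 2)) ≤ Real.exp 1 := by
    intro y
    have h := cubeMean_exp_radSum_indVec_sq_le hn
      (Finset.univ.image fun σ => Finset.univ.filter fun i => r < f σ (y i))
      (card_le_of_shatters_superlevel hF y r _ fun A hA => by
        obtain ⟨σ, -, rfl⟩ := Finset.mem_image.1 hA
        exact ⟨f σ, hf σ, by simp⟩)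
      (fun σ => Finset.univ.filter fun i => r < f σ (y i))
      (fun σ => Finset.mem_image_of_mem _ (Finset.mem_univ σ))
    refine le_of_eq_of_le ?_ h
    congr 1
    ext σ
    congr 4
    ext i
    simp [indVec, above]
  have h := cubeMean_exp_sum_sq_le (J := 2) Nat.two_pos (fun _ => 64 * (d + 1) * √(n : ℝ))
    (fun _ => by positivity)
    (fun j σ => if j = 0 then radSum σ (fun i => above r (f σ (x' i)))
      else -radSum σ (fun i => above r (f σ (x i)))) (K := Real.exp 1) (by
        intro j hj
        by_cases hj0 : j = 0
        · simpa [hj0] using key x'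
        · simpa [hj0, neg_div] using key x)
    (B := 128 * (d + 1) * √n) (by
      simp only [Finset.sum_const, Finset.card_range, nsmul_eq_mul]
      push_cast
      linarith)
  refine le_of_eq_of_le ?_ h
  congr 1
  ext σ
  congr 3
  rw [Finset.sum_range_succ, Finset.sum_range_one, if_pos rfl, if_neg one_ne_zero]
  rw [← sub_eq_add_neg]
  simp only [radSum, mul_sub, Finset.sum_sub_distrib]

/-- Layer-cake: a uniform random threshold turns the indicator of a superlevel set into an affine
function of the value. -/
lemma integral_above_cond {B v : ℝ} (hB : 0 < B) (hv : |v| ≤ B) :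
    ∫ r, above r v ∂(cond volume (Set.Ioc (-B) B)) = (v + B) / (2 * B) := by
  have h1 : (fun r => above r v) = (Set.Iio v).indicator fun _ => (1 : ℝ) := by
    ext r
    simp [above, Set.indicator]
  obtain ⟨hv1, hv2⟩ := abs_le.1 hv
  have h2 : Set.Ioc (-B) B ∩ Set.Iio v = Set.Ioo (-B) v := by
    ext r
    simp only [Set.mem_inter_iff, Set.mem_Ioc, Set.mem_Iio, Set.mem_Ioo]
    constructor
    · tauto
    · rintro ⟨h3, h4⟩
      exact ⟨⟨h3, by linarith⟩, h4⟩
  rw [h1, integral_indicator_const _ measurableSet_Iio, measureReal_def,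
    cond_apply measurableSet_Ioc, h2, Real.volume_Ioc, Real.volume_Ioo, ENNReal.toReal_mul,
    ENNReal.toReal_inv, ENNReal.toReal_ofReal (by linarith), ENNReal.toReal_ofReal (by linarith),
    smul_eq_mul, mul_one]
  field_simp
  ring

/-- Square-exponential moment of the symmetrized empirical process over a bounded class of finite
pseudo-dimension. -/
lemma cubeMean_exp_radSum_sub_sq_le {F : Set (X → ℝ)} {d : ℕ} (hF : pseudoDim F ≤ d) (hn : 0 < n)
    {B : ℝ} (hB : 0 < B) (hFB : ∀ f ∈ F, ∀ x, |f x| ≤ B)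
    (x x' : Fin n → X) (f : (Fin n → Bool) → X → ℝ) (hf : ∀ σ, f σ ∈ F) :
    cubeMean (fun σ => Real.exp ((radSum σ
      (fun i => f σ (x' i) - f σ (x i)) / (256 * B * (d + 1) * √n)) ^ 2)) ≤ Real.exp 1 := by
  have hn' : (0 : ℝ) < n := by exact_mod_cast hn
  set ρ : Measure ℝ := cond volume (Set.Ioc (-B) B) with hρ
  have : IsProbabilityMeasure ρ := by
    refine cond_isProbabilityMeasure_of_finite ?_ ?_
    · rw [Real.volume_Ioc]
      simp [hB]
    · rw [Real.volume_Ioc]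
      simp
  set c : ℝ := 128 * (d + 1) * √n with hc
  have hc0 : 0 < c := by positivity
  let G : (Fin n → Bool) → ℝ → ℝ := fun σ r =>
    radSum σ fun i => above r (f σ (x' i)) - above r (f σ (x i))
  have hGm : ∀ σ, Measurable (G σ) := by
    intro σ
    simp only [G, radSum]
    exact Finset.measurable_fun_sum _ fun i _ =>
      ((measurable_above _).sub (measurable_above _)).const_mul _
  have hGb : ∀ σ r, |G σ r| ≤ ∑ _i : Fin n, (2 : ℝ) := by
    intro σ r
    refine (Finset.abs_sum_le_sum_abs _ _).trans (Finset.sum_le_sum fun i _ => ?_)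
    rw [abs_mul, show |sgn (σ i)| = 1 by unfold sgn; split_ifs <;> simp, one_mul]
    have h1 := above_abs_le r (f σ (x' i))
    have h2 := above_abs_le r (f σ (x i))
    exact (abs_sub _ _).trans (by linarith)
  have hint : ∀ v, Integrable (fun r => above r v) ρ := fun v =>
    Integrable.of_bound (measurable_above v).aestronglyMeasurable 1
      (.of_forall fun r => above_abs_le r v)
  -- The additive constant of the layer-cake formula cancels in differences; its slope contributes
  -- the factor `2 * B`.
  have hrep : ∀ σ, radSum σ (fun i => f σ (x' i) - f σ (x i)) = 2 * B * ∫ r, G σ r ∂ρ := by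
    intro σ
    have hterm : ∀ i, Integrable (fun r =>
        sgn (σ i) * (above r (f σ (x' i)) - above r (f σ (x i)))) ρ := fun i =>
      ((hint _).sub (hint _)).const_mul _
    simp only [G, radSum]
    rw [integral_finsetSum _ fun i _ => hterm i, Finset.mul_sum]
    refine Finset.sum_congr rfl fun i _ => ?_
    rw [integral_const_mul, integral_sub (hint _) (hint _),
      integral_above_cond hB (hFB _ (hf σ) _), integral_above_cond hB (hFB _ (hf σ) _)]
    field_simp
    ring
  have hJ := fun σ => exp_mul_sq_integral_le (ρ := ρ) (hGm σ) (hGb σ)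
    (c := (c ^ 2)⁻¹) (by positivity)
  calc cubeMean (fun σ => Real.exp ((radSum σ
      (fun i => f σ (x' i) - f σ (x i)) / (256 * B * (d + 1) * √n)) ^ 2))
      = cubeMean (fun σ => Real.exp ((c ^ 2)⁻¹ * (∫ r, G σ r ∂ρ) ^ 2)) := by
        congr 1
        ext σ
        rw [hrep, show 256 * B * (d + 1) * √(n : ℝ) = 2 * B * c by rw [hc]; ring,
          mul_div_mul_left _ _ (by positivity), div_pow, inv_mul_eq_div]
    _ ≤ cubeMean (fun σ => ∫ r, Real.exp ((c ^ 2)⁻¹ * G σ r ^ 2) ∂ρ) :=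
        cubeMean_mono fun σ => (hJ σ).2
    _ = ∫ r, cubeMean (fun σ => Real.exp ((c ^ 2)⁻¹ * G σ r ^ 2)) ∂ρ :=
        cubeMean_integral (f := fun r σ => Real.exp ((c ^ 2)⁻¹ * G σ r ^ 2)) fun σ => (hJ σ).1
    _ ≤ ∫ _r, Real.exp 1 ∂ρ := by
        refine integral_mono ?_ (integrable_const _) fun r => ?_
        · simp only [cubeMean]
          exact (integrable_finsetSum _ fun σ _ => (hJ σ).1).div_const _
        · refine le_of_eq_of_le ?_ (cubeMean_exp_above_sq_le hF hn x x' f hf r)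
          congr 1
          ext σ
          rw [div_pow, inv_mul_eq_div]
    _ = Real.exp 1 := by simp

end RealClasses

/-! ### Symmetrization and the deviation tail -/

section Population

variable {X : Type u} {Z : Type*} [MeasurableSpace Z] {n : ℕ}

/-- The gap between the population mean and the empirical mean of the function `f`, pulled back along
`g`. -/
noncomputable def deviation (μ : Measure Z) (g : Z → X) (f : X → ℝ) (D : Fin n → Z) : ℝ :=
  ∫ z, f (g z) ∂μ - (1 / (n : ℝ)) * ∑ i, f (g (D i))

/-- Exchange of the two coordinates of the pairs selected by a sign pattern. -/
def swapPairs (σ : Fin n → Bool) (E : Fin n → Z × Z) (i : Fin n) : Z × Z :=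
  if σ i then E i else (E i).swap

lemma measurePreserving_swapPairs (μ : Measure Z) [IsProbabilityMeasure μ] (σ : Fin n → Bool) :
    MeasurePreserving (swapPairs (Z := Z) σ) (Measure.pi fun _ => μ.prod μ)
      (Measure.pi fun _ => μ.prod μ) := by
  refine measurePreserving_pi (fun _ => μ.prod μ) (fun _ => μ.prod μ)
    (f := fun i z => if σ i then z else z.swap) fun i => ?_
  by_cases h : σ i
  · simp only [h, if_true]
    exact MeasurePreserving.id (μ.prod μ)
  · simpa [h] using Measure.measurePreserving_swap (μ := μ) (ν := μ)

/-- Symmetrization for a measurably selected member of a bounded class of finite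
pseudo-dimension; no measurability of suprema over the class is needed. -/
lemma integral_exp_deviation_sq_le {F : Set (X → ℝ)} {d : ℕ} (hF : pseudoDim F ≤ d) (hn : 0 < n)
    {B : ℝ} (hB : 0 < B) (hFB : ∀ f ∈ F, ∀ x, |f x| ≤ B)
    (μ : Measure Z) [IsProbabilityMeasure μ] (g : Z → X) (f : (Fin n → Z) → X → ℝ)
    (hf : ∀ D, f D ∈ F) (hfm : Measurable fun q : (Fin n → Z) × Z => f q.1 (g q.2)) :
    Integrable (fun D => Real.exp ((√n * deviation μ g (f D) D / (256 * B * (d + 1))) ^ 2))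
      (Measure.pi fun _ => μ) ∧
    ∫ D, Real.exp ((√n * deviation μ g (f D) D / (256 * B * (d + 1))) ^ 2) ∂(Measure.pi fun _ => μ)
      ≤ Real.exp 1 := by
  have hn' : (0 : ℝ) < n := by exact_mod_cast hn
  set κ : Measure (Fin n → Z) := Measure.pi fun _ => μ with hκ
  set c : ℝ := 256 * B * (d + 1) * √n with hc
  have hc0 : 0 < c := by positivity
  have hfmD : ∀ D, Measurable fun z => f D (g z) := fun D => hfm.comp measurable_prodMk_left
  have hfint : ∀ D, Integrable (fun z => f D (g z)) μ := fun D =>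
    Integrable.of_bound (hfmD D).aestronglyMeasurable B (.of_forall fun z => hFB _ (hf D) _)
  let S : (Fin n → Z) × (Fin n → Z) → ℝ := fun q =>
    ∑ i, (f q.1 (g (q.2 i)) - f q.1 (g (q.1 i)))
  have hSm : Measurable S := by
    refine Finset.measurable_fun_sum _ fun i _ => Measurable.sub ?_ ?_
    · exact hfm.comp (measurable_fst.prodMk ((measurable_pi_apply i).comp measurable_snd))
    · exact hfm.comp (measurable_fst.prodMk ((measurable_pi_apply i).comp measurable_fst))
  have hSb : ∀ q, |S q| ≤ ∑ _i : Fin n, (2 * B) := by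
    intro q
    refine (Finset.abs_sum_le_sum_abs _ _).trans (Finset.sum_le_sum fun i _ => ?_)
    have h1 := hFB _ (hf q.1) (g (q.2 i))
    have h2 := hFB _ (hf q.1) (g (q.1 i))
    exact (abs_sub _ _).trans (by linarith)
  -- The selection depends on `D` alone, so averaging over an independent ghost sample `D'` produces
  -- the population mean of the selected function.
  have hghost : ∀ D, √n * deviation μ g (f D) D / (256 * B * (d + 1))
      = (∫ D', S (D, D') ∂κ) / c := by
    intro D
    have h1 : ∫ D', S (D, D') ∂κ = n * deviation μ g (f D) D := by
      have h2 : ∀ i : Fin n, Integrable (fun D' : Fin n → Z => f D (g (D' i))) κ := fun i =>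
        (measurePreserving_eval (fun _ : Fin n => μ) i).integrable_comp_of_integrable (hfint D)
      have h3 : ∀ i : Fin n, ∫ D', f D (g (D' i)) ∂κ = ∫ z, f D (g z) ∂μ := fun i => by
        have h4 := measurePreserving_eval (fun _ : Fin n => μ) i
        rw [← h4.map_eq, integral_map h4.measurable.aemeasurable
          (hfmD D).aestronglyMeasurable]
      have h5 : ∀ i : Fin n, Integrable
          (fun D' : Fin n → Z => f D (g (D' i)) - f D (g (D i))) κ := fun i =>
        (h2 i).sub (integrable_const _)
      simp only [S]
      rw [integral_finsetSum _ fun i _ => h5 i]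
      simp only [integral_sub (h2 _) (integrable_const _), h3, Finset.sum_sub_distrib,
        integral_const, probReal_univ, one_smul, Finset.sum_const, Finset.card_univ,
        Fintype.card_fin, nsmul_eq_mul, deviation]
      field_simp
    rw [h1, hc]
    nth_rewrite 2 [← Real.mul_self_sqrt hn'.le]
    have : √(n : ℝ) ≠ 0 := by positivity
    field_simp
  let Φ : (Fin n → Z) × (Fin n → Z) → ℝ := fun q => Real.exp ((c ^ 2)⁻¹ * S q ^ 2)
  have hΦ : Integrable Φ (κ.prod κ) :=
    (exp_mul_sq_integral_le (ρ := κ.prod κ) hSm hSb (by positivity)).1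
  have hJ : ∀ D, Real.exp ((√n * deviation μ g (f D) D / (256 * B * (d + 1))) ^ 2)
      ≤ ∫ D', Φ (D, D') ∂κ := by
    intro D
    rw [hghost, div_pow, ← inv_mul_eq_div]
    exact (exp_mul_sq_integral_le (ρ := κ) (hSm.comp measurable_prodMk_left)
      (fun D' => hSb (D, D')) (by positivity)).2
  have hΦ1 : Integrable (fun D => ∫ D', Φ (D, D') ∂κ) κ := hΦ.integral_prod_left
  have hdm : Measurable fun D => ∫ D', S (D, D') ∂κ :=
    (StronglyMeasurable.integral_prod_right (f := fun D D' => S (D, D'))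
      hSm.stronglyMeasurable).measurable
  have hLint : Integrable
      (fun D => Real.exp ((√n * deviation μ g (f D) D / (256 * B * (d + 1))) ^ 2)) κ := by
    refine hΦ1.mono' ?_ (.of_forall fun D => ?_)
    · simp only [hghost]
      exact (by fun_prop : Measurable fun D =>
        Real.exp (((∫ D', S (D, D') ∂κ) / c) ^ 2)).aestronglyMeasurable
    · rw [Real.norm_eq_abs, Real.abs_exp]
      exact hJ D
  refine ⟨hLint, (integral_mono hLint hΦ1 hJ).trans ?_⟩
  rw [← integral_prod _ hΦ]
  have harr := measurePreserving_arrowProdEquivProdArrow Z Z (Fin n) (fun _ => μ) fun _ => μ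
  set e := MeasurableEquiv.arrowProdEquivProdArrow Z Z (Fin n)
  have hswap : ∀ σ : Fin n → Bool, MeasurePreserving (fun E => e (swapPairs σ E))
      (Measure.pi fun _ => μ.prod μ) (κ.prod κ) := fun σ =>
    harr.comp (measurePreserving_swapPairs μ σ)
  -- Swapping within pairs preserves the joint law, so one may average over all `σ`. For fixed pairs
  -- `E` the selected function then varies with `σ`, which is why the cube bounds allow
  -- sign-dependent selections.
  have hcong : ∀ σ : Fin n → Bool, ∫ q, Φ q ∂(κ.prod κ)
      = ∫ E, Φ (e (swapPairs σ E)) ∂(Measure.pi fun _ => μ.prod μ) := by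
    intro σ
    rw [← (hswap σ).map_eq, integral_map (hswap σ).measurable.aemeasurable]
    rw [(hswap σ).map_eq]
    exact hΦ.aestronglyMeasurable
  have hΦσ : ∀ σ : Fin n → Bool, Integrable (fun E => Φ (e (swapPairs σ E)))
      (Measure.pi fun _ => μ.prod μ) := fun σ =>
    (hswap σ).integrable_comp_of_integrable hΦ
  calc ∫ q, Φ q ∂(κ.prod κ)
      = cubeMean (fun σ : Fin n → Bool => ∫ q, Φ q ∂(κ.prod κ)) := (cubeMean_const _).symm
    _ = cubeMean (fun σ : Fin n → Bool =>
          ∫ E, Φ (e (swapPairs σ E)) ∂(Measure.pi fun _ => μ.prod μ)) := by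
        congr 1
        ext σ
        exact hcong σ
    _ = ∫ E, cubeMean (fun σ => Φ (e (swapPairs σ E))) ∂(Measure.pi fun _ => μ.prod μ) :=
        cubeMean_integral (f := fun E σ => Φ (e (swapPairs σ E))) hΦσ
    _ ≤ ∫ _E, Real.exp 1 ∂(Measure.pi fun _ : Fin n => μ.prod μ) := by
        refine integral_mono ?_ (integrable_const _) fun E => ?_
        · simp only [cubeMean]
          exact (integrable_finsetSum _ fun σ _ => hΦσ σ).div_const _
        · refine le_of_eq_of_le ?_ (cubeMean_exp_radSum_sub_sq_le hF hn hB hFB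
            (fun i => g (E i).1) (fun i => g (E i).2)
            (fun σ => f fun i => (swapPairs σ E i).1) fun σ => hf _)
          congr 1
          ext σ
          simp only [Φ]
          rw [inv_mul_eq_div, ← div_pow]
          congr 3
          simp only [S, radSum]
          refine Finset.sum_congr rfl fun i _ => ?_
          change f (fun i => (swapPairs σ E i).1) (g (swapPairs σ E i).2)
            - f (fun i => (swapPairs σ E i).1) (g (swapPairs σ E i).1) = _
          by_cases hσ : σ i
          · rw [show swapPairs σ E i = E i by simp [swapPairs, hσ]]
            simp [sgn, hσ]
          · rw [show swapPairs σ E i = (E i).swap by simp [swapPairs, hσ]]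
            simp [sgn, hσ]
    _ = Real.exp 1 := by simp

/-- Uniform deviation bound at the rate `n ^ (-1/2)` for a measurably selected member of the
class. -/
lemma measure_deviation_gt_le {F : Set (X → ℝ)} {d : ℕ} (hF : pseudoDim F ≤ d) (hn : 0 < n)
    {B : ℝ} (hB : 0 < B) (hFB : ∀ f ∈ F, ∀ x, |f x| ≤ B)
    (μ : Measure Z) [IsProbabilityMeasure μ] (g : Z → X) (f : (Fin n → Z) → X → ℝ)
    (hf : ∀ D, f D ∈ F) (hfm : Measurable fun q : (Fin n → Z) × Z => f q.1 (g q.2))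
    {δ : ℝ} (hδ : 0 < δ) :
    Measure.pi (fun _ => μ)
      {D | 256 * B * (d + 1) * √((1 + Real.log (1 / δ)) / n) < |deviation μ g (f D) D|}
      ≤ ENNReal.ofReal δ := by
  have hn' : (0 : ℝ) < n := by exact_mod_cast hn
  obtain ⟨hint, hle⟩ := integral_exp_deviation_sq_le hF hn hB hFB μ g f hf hfm
  have hb0 : 0 < 256 * B * ((d : ℝ) + 1) := by positivity
  have hM := mul_meas_ge_le_integral_of_nonneg (.of_forall fun D => (Real.exp_pos _).le) hint
    (Real.exp 1 / δ)
  have hsub : {D | 256 * B * (d + 1) * √((1 + Real.log (1 / δ)) / n) < |deviation μ g (f D) D|}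
      ⊆ {D | Real.exp 1 / δ
        ≤ Real.exp ((√n * deviation μ g (f D) D / (256 * B * (d + 1))) ^ 2)} := by
    intro D hD
    simp only [Set.mem_ofPred_eq] at hD ⊢
    have h1 : Real.exp 1 / δ = Real.exp (1 + Real.log (1 / δ)) := by
      rw [Real.exp_add, Real.exp_log (by positivity)]
      ring
    rw [h1, Real.exp_le_exp]
    -- Large `δ` is not excluded; there the exponent to be beaten is nonpositive.
    rcases le_or_gt (1 + Real.log (1 / δ)) 0 with h0 | h0
    · exact h0.trans (sq_nonneg _)
    have h2 : √((1 + Real.log (1 / δ)) / n) ≤ |deviation μ g (f D) D| / (256 * B * (d + 1)) := by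
      rw [le_div_iff₀ hb0, mul_comm]
      exact hD.le
    have h3 := pow_le_pow_left₀ (Real.sqrt_nonneg _) h2 2
    rw [Real.sq_sqrt (by positivity), div_pow, sq_abs, div_le_iff₀ hn'] at h3
    rw [div_pow, mul_pow, Real.sq_sqrt hn'.le]
    linarith [h3, mul_div_assoc (n : ℝ) (deviation μ g (f D) D ^ 2) ((256 * B * (d + 1)) ^ 2)]
  refine (measure_mono hsub).trans ?_
  have hreal := hM.trans hle
  rw [div_mul_eq_mul_div, div_le_iff₀ hδ] at hreal
  have := le_of_mul_le_mul_left hreal (Real.exp_pos 1)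
  rw [← ofReal_measureReal]
  exact ENNReal.ofReal_le_ofReal this

end Population

end UncoupledRegression

namespace UncoupledRegression

/-! ### Deviations under extra independent data -/

section Product

variable {X : Type u} {Z W : Type*} [MeasurableSpace Z] [MeasurableSpace W] {n : ℕ}

/-- The deviation bound when the selection uses additional independent data. -/
lemma measure_prod_deviation_gt_le {F : Set (X → ℝ)} {d : ℕ} (hF : pseudoDim F ≤ d) (hn : 0 < n)
    {B : ℝ} (hB : 0 < B) (hFB : ∀ f ∈ F, ∀ x, |f x| ≤ B)
    (μ : Measure Z) [IsProbabilityMeasure μ] (ν : Measure W) [IsProbabilityMeasure ν]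
    (g : Z → X) (f : (Fin n → Z) × W → X → ℝ) (hf : ∀ D, f D ∈ F)
    (hfm : Measurable fun q : ((Fin n → Z) × W) × Z => f q.1 (g q.2)) {δ : ℝ} (hδ : 0 < δ) :
    ((Measure.pi fun _ => μ).prod ν)
      {D | 256 * B * (d + 1) * √((1 + Real.log (1 / δ)) / n) < |deviation μ g (f D) D.1|}
      ≤ ENNReal.ofReal δ := by
  have hm : Measurable fun D : (Fin n → Z) × W => deviation μ g (f D) D.1 := by
    unfold deviation
    refine Measurable.sub ?_ (Measurable.const_mul (Finset.measurable_fun_sum _ fun i _ => ?_) _)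
    · exact (StronglyMeasurable.integral_prod_right (f := fun D z => f D (g z))
        hfm.stronglyMeasurable).measurable
    · exact hfm.comp (measurable_id.prodMk ((measurable_pi_apply i).comp measurable_fst))
  rw [Measure.prod_apply_symm (measurableSet_lt measurable_const (by fun_prop))]
  calc ∫⁻ w, (Measure.pi fun _ => μ) ((fun D => (D, w)) ⁻¹' {D : (Fin n → Z) × W |
        256 * B * (d + 1) * √((1 + Real.log (1 / δ)) / n) < |deviation μ g (f D) D.1|}) ∂ν
      ≤ ∫⁻ _w, ENNReal.ofReal δ ∂ν := by
        -- With `w` frozen, the selection is a measurable rule of the sample alone.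
        refine lintegral_mono fun w => ?_
        refine measure_deviation_gt_le hF hn hB hFB μ g (fun D => f (D, w)) (fun D => hf _) ?_ hδ
        exact hfm.comp ((measurable_prodMk_right.comp measurable_fst).prodMk measurable_snd)
    _ = ENNReal.ofReal δ := by simp

lemma measure_prod_deviation_gt_le' {F : Set (X → ℝ)} {d : ℕ} (hF : pseudoDim F ≤ d) (hn : 0 < n)
    {B : ℝ} (hB : 0 < B) (hFB : ∀ f ∈ F, ∀ x, |f x| ≤ B)
    (μ : Measure Z) [IsProbabilityMeasure μ] (ν : Measure W) [IsProbabilityMeasure ν]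
    (g : Z → X) (f : W × (Fin n → Z) → X → ℝ) (hf : ∀ D, f D ∈ F)
    (hfm : Measurable fun q : (W × (Fin n → Z)) × Z => f q.1 (g q.2)) {δ : ℝ} (hδ : 0 < δ) :
    (ν.prod (Measure.pi fun _ => μ))
      {D | 256 * B * (d + 1) * √((1 + Real.log (1 / δ)) / n) < |deviation μ g (f D) D.2|}
      ≤ ENNReal.ofReal δ := by
  rw [← Measure.prod_swap]
  change (Measure.map MeasurableEquiv.prodComm _) _ ≤ _
  rw [MeasurableEquiv.map_apply]
  refine measure_prod_deviation_gt_le hF hn hB hFB μ ν g (fun D => f D.swap) (fun D => hf _) ?_ hδ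
  exact hfm.comp ((measurable_swap.comp measurable_fst).prodMk measurable_snd)

end Product

/-! ### The approximated risk and its bias -/

section Risk

variable {X : Type u} [MeasurableSpace X]

/-- `φ` itself need not be measurable. Its differentiability points form a measurable set on which
it is continuous, and `q` takes values there. -/
lemma measurable_comp_of_differentiableAt {α : Type*} [MeasurableSpace α] {φ : ℝ → ℝ} {q : α → ℝ}
    (hq : Measurable q) (h : ∀ a, DifferentiableAt ℝ φ (q a)) : Measurable fun a => φ (q a) := by
  have hS : MeasurableSet {x | DifferentiableAt ℝ φ x} := measurableSet_of_differentiableAt ℝ φ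
  have hc : ContinuousOn φ {x | DifferentiableAt ℝ φ x} := fun x hx =>
    (ContinuousAt.continuousWithinAt (DifferentiableAt.continuousAt hx))
  have h1 : Measurable ({x | DifferentiableAt ℝ φ x}.domRestrict φ) :=
    (continuousOn_iff_continuous_domRestrict.1 hc).measurable
  exact h1.comp (hq.subtype_mk (h := h))

lemma measurable_orderPair : Measurable fun q : (X × ℝ) × (X × ℝ) =>
    if q.2.2 ≤ q.1.2 then (q.1.1, q.2.1) else (q.2.1, q.1.1) :=
  Measurable.ite (measurableSet_le (by fun_prop) (by fun_prop)) (by fun_prop) (by fun_prop)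

instance isProbabilityMeasure_pairLaw (P : Measure (X × ℝ)) [IsProbabilityMeasure P] :
    IsProbabilityMeasure (pairLaw P) :=
  Measure.isProbabilityMeasure_map measurable_orderPair.aemeasurable

variable {P : Measure (X × ℝ)}

lemma measure_snd_le_eq_cdf [IsProbabilityMeasure P] (y : ℝ) : P.real {p | p.2 ≤ y} = cdf P.snd y := by
  rw [cdf_eq_real, measureReal_def, measureReal_def, Measure.snd_apply measurableSet_Iic]
  rfl

/-- The one place where the continuity of the target law enters: ties have probability zero. -/
lemma measure_snd_lt_eq_cdf [IsProbabilityMeasure P] (h0 : ∀ y, P.snd {y} = 0) (y : ℝ) :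
    P.real {p | p.2 < y} = cdf P.snd y := by
  rw [cdf_eq_real, measureReal_def, measureReal_def]
  have : NullSingletonClass P.snd := ⟨h0⟩
  rw [← measure_congr (Iio_ae_eq_Iic (μ := P.snd) (a := y)), Measure.snd_apply measurableSet_Iio]
  rfl

lemma integrable_of_measurable_of_abs_le {α : Type*} [MeasurableSpace α] {μ : Measure α}
    [IsFiniteMeasure μ] {f : α → ℝ} (hf : Measurable f) {C : ℝ} (hC : ∀ a, |f a| ≤ C) :
    Integrable f μ :=
  Integrable.of_bound hf.aestronglyMeasurable C (.of_forall hC)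

/-- Fubini in the second draw. The relation `r` is kept general to serve both `≤` and `<`, which the
tie-breaking rule of the pair requires. -/
lemma integral_prod_ite_mul [IsProbabilityMeasure P] {r : ℝ → ℝ → Prop} [∀ y y', Decidable (r y y')]
    (hr : MeasurableSet {q : (X × ℝ) × (X × ℝ) | r q.1.2 q.2.2})
    (hcdf : ∀ y, P.real {p | r y p.2} = cdf P.snd y)
    {g : X → ℝ} (hg : Measurable g) {C : ℝ} (hC : ∀ x, |g x| ≤ C) :
    Integrable (fun q : (X × ℝ) × (X × ℝ) => if r q.1.2 q.2.2 then g q.1.1 else 0) (P.prod P) ∧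
    ∫ q, (if r q.1.2 q.2.2 then g q.1.1 else 0) ∂(P.prod P)
      = ∫ p, cdf P.snd p.2 * g p.1 ∂P := by
  have hC0 : ∀ x, 0 ≤ C := fun x => (abs_nonneg _).trans (hC x)
  have hint : Integrable (fun q : (X × ℝ) × (X × ℝ) => if r q.1.2 q.2.2 then g q.1.1 else 0)
      (P.prod P) := by
    refine integrable_of_measurable_of_abs_le
      (Measurable.ite hr (by fun_prop) measurable_const) (C := C) fun q => ?_
    split_ifs
    · exact hC _
    · simpa using hC0 q.1.1
  refine ⟨hint, ?_⟩
  rw [integral_prod _ hint]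
  refine integral_congr_ae (.of_forall fun p => ?_)
  have h1 : (fun p' : X × ℝ => if r p.2 p'.2 then g p.1 else 0)
      = {p' : X × ℝ | r p.2 p'.2}.indicator fun _ => g p.1 := by
    ext p'
    simp [Set.indicator]
  have h2 : MeasurableSet {p' : X × ℝ | r p.2 p'.2} := measurable_prodMk_left (x := p) hr
  simp only [h1]
  rw [integral_indicator_const _ h2, hcdf, smul_eq_mul]

/-- The law of the preferred item: `E[g(X⁺)] = 2 E[F_Y(Y) g(X)]`. -/
lemma integral_pairLaw_fst [IsProbabilityMeasure P] (h0 : ∀ y, P.snd {y} = 0) {g : X → ℝ} (hg : Measurable g) {C : ℝ}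
    (hC : ∀ x, |g x| ≤ C) :
    ∫ p, g p.1 ∂pairLaw P = 2 * ∫ p, cdf P.snd p.2 * g p.1 ∂P := by
  classical
  rw [pairLaw, integral_map measurable_orderPair.aemeasurable
    (by fun_prop : Measurable fun p : X × X => g p.1).aestronglyMeasurable]
  obtain ⟨hi1, he1⟩ := integral_prod_ite_mul (P := P) (r := fun y y' => y' ≤ y)
    (measurableSet_le (by fun_prop) (by fun_prop)) measure_snd_le_eq_cdf hg hC
  obtain ⟨hi2, he2⟩ := integral_prod_ite_mul (P := P) (r := fun y y' => y' < y)
    (measurableSet_lt (by fun_prop) (by fun_prop)) (measure_snd_lt_eq_cdf h0) hg hC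
  have hi3 : Integrable (fun q : (X × ℝ) × (X × ℝ) =>
      if q.swap.2.2 < q.swap.1.2 then g q.swap.1.1 else 0) (P.prod P) := hi2.swap
  have he3 := integral_prod_swap (μ := P) (ν := P)
    (fun q : (X × ℝ) × (X × ℝ) => if q.2.2 < q.1.2 then g q.1.1 else 0)
  -- Either the first draw wins weakly or the second wins strictly; exchanging the draws reduces the
  -- second case to the first with `<`.
  have hsplit : ∀ q : (X × ℝ) × (X × ℝ),
      g (if q.2.2 ≤ q.1.2 then (q.1.1, q.2.1) else (q.2.1, q.1.1)).1
        = (if q.2.2 ≤ q.1.2 then g q.1.1 else 0)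
          + (fun q : (X × ℝ) × (X × ℝ) => if q.2.2 < q.1.2 then g q.1.1 else 0) q.swap := by
    intro q
    by_cases h : q.2.2 ≤ q.1.2
    · simp [h, not_lt.2 h]
    · simp [h, not_le.1 h]
  simp only [hsplit]
  rw [integral_add hi1 hi3, he3, he1, he2]
  ring

/-- Ordering a pair does not change a symmetric sum. This yields the law of `X⁻` from that of `X⁺`,
and the cancellation of `lam`. -/
lemma integral_pairLaw_fst_add_snd [IsProbabilityMeasure P] {g : X → ℝ} (hg : Measurable g) {C : ℝ}
    (hC : ∀ x, |g x| ≤ C) :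
    ∫ p, g p.1 ∂pairLaw P + ∫ p, g p.2 ∂pairLaw P = 2 * ∫ p, g p.1 ∂P := by
  have hb1 : Integrable (fun p : X × X => g p.1) (pairLaw P) :=
    integrable_of_measurable_of_abs_le (by fun_prop) fun p => hC _
  have hb2 : Integrable (fun p : X × X => g p.2) (pairLaw P) :=
    integrable_of_measurable_of_abs_le (by fun_prop) fun p => hC _
  have hb3 : Integrable (fun p : X × ℝ => g p.1) P :=
    integrable_of_measurable_of_abs_le (by fun_prop) fun p => hC _
  rw [← integral_add hb1 hb2, pairLaw, integral_map measurable_orderPair.aemeasurable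
    (by fun_prop : Measurable fun p : X × X => g p.1 + g p.2).aestronglyMeasurable]
  have hsplit : ∀ q : (X × ℝ) × (X × ℝ),
      g (if q.2.2 ≤ q.1.2 then (q.1.1, q.2.1) else (q.2.1, q.1.1)).1
        + g (if q.2.2 ≤ q.1.2 then (q.1.1, q.2.1) else (q.2.1, q.1.1)).2
        = g q.1.1 + g q.2.1 := by
    intro q
    split_ifs
    · rfl
    · exact add_comm _ _
  simp only [hsplit]
  rw [integral_add (hb3.comp_fst P) (hb3.comp_snd P),
    integral_fun_fst (fun p : X × ℝ => g p.1), integral_fun_snd (fun p : X × ℝ => g p.1)]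
  simp [two_mul]

/-- The population version of the empirical approximated risk. -/
noncomputable def approxRisk (P : Measure (X × ℝ)) (φ : ℝ → ℝ) (lam w₁ w₂ : ℝ) (h : X → ℝ) : ℝ :=
  (∫ y, φ y ∂P.snd) + (∫ x, h x * deriv φ (h x) - φ (h x) ∂P.fst)
    - lam * (∫ x, deriv φ (h x) ∂P.fst)
    - ((w₁ - lam / 2) * (∫ p, deriv φ (h p.1) ∂pairLaw P)
      + (w₂ - lam / 2) * (∫ p, deriv φ (h p.2) ∂pairLaw P))

lemma integral_fst_eq {g : X → ℝ} (hg : Measurable g) : ∫ x, g x ∂P.fst = ∫ p, g p.1 ∂P :=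
  integral_map measurable_fst.aemeasurable hg.aestronglyMeasurable

lemma cdf_mem_Icc (y : ℝ) : cdf P.snd y ∈ Set.Icc (0 : ℝ) 1 :=
  ⟨cdf_nonneg _ _, cdf_le_one _ _⟩

variable {Ys : Set ℝ} {φ : ℝ → ℝ} {H : Set (X → ℝ)} {m M : ℝ}

lemma IsProblem.measurable_deriv_comp (hP : IsProblem P Ys φ H m M) {h : X → ℝ} (hh : h ∈ H) :
    Measurable fun x => deriv φ (h x) :=
  (measurable_deriv φ).comp (hP.model_measurable h hh)

lemma IsProblem.measurable_conj (hP : IsProblem P Ys φ H m M) {h : X → ℝ} (hh : h ∈ H) :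
    Measurable fun x => h x * deriv φ (h x) - φ (h x) :=
  ((hP.model_measurable h hh).mul (hP.measurable_deriv_comp hh)).sub
    (measurable_comp_of_differentiableAt (hP.model_measurable h hh)
      (hP.generator_differentiable h hh))

/-- This isolates the only term that involves `X` and `Y` jointly; it is integrable because `φ'(h)`
is bounded. -/
lemma IsProblem.risk_eq [IsProbabilityMeasure P] (hP : IsProblem P Ys φ H m M) {h : X → ℝ} (hh : h ∈ H) :
    Integrable (fun p : X × ℝ => p.2 * deriv φ (h p.1)) P ∧
    risk P φ h = (∫ y, φ y ∂P.snd) + (∫ x, h x * deriv φ (h x) - φ (h x) ∂P.fst)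
      - ∫ p, p.2 * deriv φ (h p.1) ∂P := by
  have hsnd : MeasurePreserving Prod.snd P P.snd := ⟨measurable_snd, rfl⟩
  have hd := hP.measurable_deriv_comp hh
  have hk := hP.measurable_conj hh
  have hi1 : Integrable (fun p : X × ℝ => φ p.2) P :=
    hsnd.integrable_comp_of_integrable hP.generator_integrable
  have hi2 : Integrable (fun p : X × ℝ => h p.1 * deriv φ (h p.1) - φ (h p.1)) P :=
    integrable_of_measurable_of_abs_le (hk.comp measurable_fst) fun p => hP.conj_bound h hh _
  have hi3 : Integrable (fun p : X × ℝ => p.2 * deriv φ (h p.1)) P :=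
    (hsnd.integrable_comp_of_integrable hP.target_integrable).mul_bdd (c := M)
      (hd.comp measurable_fst).aestronglyMeasurable
      (.of_forall fun p => hP.deriv_bound h hh _)
  refine ⟨hi3, ?_⟩
  have h1 : ∫ y, φ y ∂P.snd = ∫ p, φ p.2 ∂P :=
    integral_map measurable_snd.aemeasurable hP.generator_integrable.aestronglyMeasurable
  have hi12 : Integrable (fun p : X × ℝ => φ p.2 + (h p.1 * deriv φ (h p.1) - φ (h p.1))) P :=
    hi1.add hi2
  rw [h1, integral_fst_eq hk, ← integral_add hi1 hi2, ← integral_sub hi12 hi3, risk]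
  refine integral_congr_ae (.of_forall fun p => ?_)
  simp only [bregman]
  ring

/-- The approximated risk differs from the risk by at most `M * Err`. -/
lemma IsProblem.abs_approxRisk_sub_risk_le [IsProbabilityMeasure P] (hP : IsProblem P Ys φ H m M) (lam w₁ w₂ : ℝ)
    {h : X → ℝ} (hh : h ∈ H) :
    |approxRisk P φ lam w₁ w₂ h - risk P φ h| ≤ M * Err P w₁ w₂ := by
  have hd := hP.measurable_deriv_comp hh
  have hdb := hP.deriv_bound h hh
  obtain ⟨hi1, hrisk⟩ := hP.risk_eq hh
  have hcdf : Measurable fun y => cdf P.snd y := (monotone_cdf P.snd).measurable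
  have hi2 : Integrable (fun p : X × ℝ => deriv φ (h p.1)) P :=
    integrable_of_measurable_of_abs_le (hd.comp measurable_fst) fun p => hdb _
  have hi3 : Integrable (fun p : X × ℝ => cdf P.snd p.2 * deriv φ (h p.1)) P := by
    refine hi2.bdd_mul (c := 1) (hcdf.comp measurable_snd).aestronglyMeasurable
      (.of_forall fun p => ?_)
    rw [Real.norm_eq_abs, abs_of_nonneg (cdf_mem_Icc _).1]
    exact (cdf_mem_Icc _).2
  have hplus := integral_pairLaw_fst hP.target_continuous hd hdb
  have hsum := integral_pairLaw_fst_add_snd (P := P) hd hdb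
  let u : ℝ → ℝ := fun y => y - 2 * w₁ * cdf P.snd y - 2 * w₂ * (1 - cdf P.snd y)
  have hdiff : approxRisk P φ lam w₁ w₂ h - risk P φ h
      = ∫ p, u p.2 * deriv φ (h p.1) ∂P := by
    have hu : (fun p : X × ℝ => u p.2 * deriv φ (h p.1)) = fun p =>
        p.2 * deriv φ (h p.1) - 2 * w₂ * deriv φ (h p.1)
          - (2 * w₁ - 2 * w₂) * (cdf P.snd p.2 * deriv φ (h p.1)) := by
      ext p
      simp only [u]
      ring
    have hi12 : Integrable (fun p : X × ℝ =>
        p.2 * deriv φ (h p.1) - 2 * w₂ * deriv φ (h p.1)) P := hi1.sub (hi2.const_mul _)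
    rw [hu, integral_sub hi12 (hi3.const_mul _),
      integral_sub hi1 (hi2.const_mul _), integral_const_mul, integral_const_mul, hrisk,
      approxRisk, integral_fst_eq hd]
    have hminus : ∫ p, deriv φ (h p.2) ∂pairLaw P
        = 2 * ∫ p, deriv φ (h p.1) ∂P - 2 * ∫ p, cdf P.snd p.2 * deriv φ (h p.1) ∂P := by
      linarith
    rw [hplus, hminus]
    ring
  have hu_meas : Measurable u := by fun_prop
  have hu_int : Integrable u P.snd := by
    have hc : Integrable (fun y => cdf P.snd y) P.snd := by
      refine integrable_of_measurable_of_abs_le hcdf (C := 1) fun y => ?_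
      rw [abs_of_nonneg (cdf_mem_Icc _).1]
      exact (cdf_mem_Icc _).2
    exact (hP.target_integrable.sub (hc.const_mul _)).sub
      (((integrable_const 1).sub hc).const_mul _)
  have hErr : Err P w₁ w₂ = ∫ p, |u p.2| ∂P :=
    integral_map measurable_snd.aemeasurable hu_meas.abs.aestronglyMeasurable
  have hup : Integrable (fun p : X × ℝ => |u p.2|) P :=
    (MeasurePreserving.integrable_comp_of_integrable (⟨measurable_snd, rfl⟩ :
      MeasurePreserving Prod.snd P P.snd) hu_int).abs
  rw [hdiff, hErr, ← integral_const_mul]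
  refine (abs_integral_le_integral_abs).trans ?_
  refine integral_mono_of_nonneg (.of_forall fun p => abs_nonneg _) (hup.const_mul M)
    (.of_forall fun p => ?_)
  simp only [abs_mul]
  rw [mul_comm]
  exact mul_le_mul_of_nonneg_right (hdb _) (abs_nonneg _)

/-- The constant `E[φ(Y)]` cancels. The `lam` part is split off so that each deviation runs over a
class of controlled pseudo-dimension. -/
lemma approxRisk_sub_empRisk (lam w₁ w₂ : ℝ) {nU nR : ℕ} (D : RAData X nU nR) (h : X → ℝ) :
    approxRisk P φ lam w₁ w₂ h - empRisk P φ lam w₁ w₂ D h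
      = deviation P.fst id (fun x => h x * deriv φ (h x) - φ (h x)) D.1
        - lam * deviation P.fst id (fun x => deriv φ (h x)) D.1
        - ((w₁ - lam / 2) * deviation (pairLaw P) Prod.fst (fun x => deriv φ (h x)) D.2
          + (w₂ - lam / 2) * deviation (pairLaw P) Prod.snd (fun x => deriv φ (h x)) D.2) := by
  have h1 : ∑ i, (φ (h (D.1 i)) - (h (D.1 i) - lam) * deriv φ (h (D.1 i)))
      = -(∑ i, (h (D.1 i) * deriv φ (h (D.1 i)) - φ (h (D.1 i))))
        + lam * ∑ i, deriv φ (h (D.1 i)) := by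
    rw [Finset.mul_sum, ← Finset.sum_neg_distrib, ← Finset.sum_add_distrib]
    exact Finset.sum_congr rfl fun i _ => by ring
  simp only [approxRisk, empRisk, deviation, id, h1, Finset.sum_add_distrib, ← Finset.mul_sum]
  ring

end Risk

end UncoupledRegression

namespace UncoupledRegression

/-! ### Excess risk of the estimator -/

section Excess

variable {X : Type u} [MeasurableSpace X] {P : Measure (X × ℝ)} {Ys : Set ℝ} {φ : ℝ → ℝ}
  {H : Set (X → ℝ)} {m M : ℝ}

/-- The width of the deviation bound for a class bounded by `B` of pseudo-dimension `d`. -/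
noncomputable def width (B : ℝ) (d n : ℕ) (δ : ℝ) : ℝ :=
  256 * (|B| + 1) * (d + 1) * √((1 + Real.log (1 / δ)) / n)

instance isProbabilityMeasure_dataLaw [IsProbabilityMeasure P] (nU nR : ℕ) :
    IsProbabilityMeasure (dataLaw P nU nR) := by
  unfold dataLaw
  infer_instance

/-- The deviations of the empirical means that enter the approximated risk of `h` are within the
widths. -/
def SmallDeviations (P : Measure (X × ℝ)) (φ : ℝ → ℝ) (m M : ℝ) (d d' : ℕ) (δ : ℝ) {nU nR : ℕ}
    (D : RAData X nU nR) (h : X → ℝ) : Prop :=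
  |deviation P.fst id (fun x => h x * deriv φ (h x) - φ (h x)) D.1| ≤ width m d' nU δ ∧
  |deviation P.fst id (fun x => deriv φ (h x)) D.1| ≤ width M d nU δ ∧
  |deviation (pairLaw P) Prod.fst (fun x => deriv φ (h x)) D.2| ≤ width M d nR δ ∧
  |deviation (pairLaw P) Prod.snd (fun x => deriv φ (h x)) D.2| ≤ width M d nR δ

lemma SmallDeviations.abs_sub_le {d d' : ℕ} {δ : ℝ} {nU nR : ℕ} {D : RAData X nU nR} {h : X → ℝ}
    (hD : SmallDeviations P φ m M d d' δ D h) (lam w₁ w₂ : ℝ) :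
    |approxRisk P φ lam w₁ w₂ h - empRisk P φ lam w₁ w₂ D h|
      ≤ width m d' nU δ + |lam| * width M d nU δ
        + (|w₁ - lam / 2| + |w₂ - lam / 2|) * width M d nR δ := by
  obtain ⟨h1, h2, h3, h4⟩ := hD
  rw [approxRisk_sub_empRisk]
  refine (abs_sub _ _).trans ?_
  refine add_le_add ((abs_sub _ _).trans (add_le_add h1 ?_)) ((abs_add_le _ _).trans ?_)
  · rw [abs_mul]
    exact mul_le_mul_of_nonneg_left h2 (abs_nonneg _)
  · rw [abs_mul, abs_mul, add_mul]
    exact add_le_add (mul_le_mul_of_nonneg_left h3 (abs_nonneg _))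
      (mul_le_mul_of_nonneg_left h4 (abs_nonneg _))

/-- All the deviations of a measurably selected model are small with high probability. -/
lemma IsProblem.measure_deviations_le [IsProbabilityMeasure P]
    (hP : IsProblem P Ys φ H m M) {d d' : ℕ}
    (hd : pseudoDim (derivClass φ H) ≤ (d : ℕ∞)) (hd' : pseudoDim (conjClass φ H) ≤ (d' : ℕ∞))
    {nU nR : ℕ} (hU : 0 < nU) (hR : 0 < nR) {s : RAData X nU nR → X → ℝ} (hs : ∀ D, s D ∈ H)
    (hsm : Measurable fun q : RAData X nU nR × X => s q.1 q.2) {δ : ℝ} (hδ : 0 < δ) :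
    dataLaw P nU nR {D | ¬ SmallDeviations P φ m M d d' δ D (s D)}
      ≤ 4 * ENNReal.ofReal δ := by
  -- The deviation bound needs a strictly positive bound on the class, hence `|M| + 1` in place of
  -- `M`.
  have hMB : ∀ f ∈ derivClass φ H, ∀ x, |f x| ≤ |M| + 1 := by
    rintro _ ⟨h, hh, rfl⟩ x
    exact (hP.deriv_bound h hh x).trans ((le_abs_self M).trans (by linarith))
  have hmB : ∀ f ∈ conjClass φ H, ∀ x, |f x| ≤ |m| + 1 := by
    rintro _ ⟨h, hh, rfl⟩ x
    exact (hP.conj_bound h hh x).trans ((le_abs_self m).trans (by linarith))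
  have hdm : Measurable fun q : RAData X nU nR × X => deriv φ (s q.1 q.2) :=
    (measurable_deriv φ).comp hsm
  have hkm : Measurable fun q : RAData X nU nR × X =>
      s q.1 q.2 * deriv φ (s q.1 q.2) - φ (s q.1 q.2) :=
    (hsm.mul hdm).sub (measurable_comp_of_differentiableAt hsm fun q =>
      hP.generator_differentiable _ (hs q.1) _)
  have e1 : dataLaw P nU nR {D | width m d' nU δ
      < |deviation P.fst id (fun x => s D x * deriv φ (s D x) - φ (s D x)) D.1|}
      ≤ ENNReal.ofReal δ :=
    measure_prod_deviation_gt_le hd' hU (B := |m| + 1) (by positivity) hmB P.fst _ id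
      (fun D x => s D x * deriv φ (s D x) - φ (s D x)) (fun D => ⟨s D, hs D, rfl⟩) hkm hδ
  have e2 : dataLaw P nU nR {D | width M d nU δ
      < |deviation P.fst id (fun x => deriv φ (s D x)) D.1|} ≤ ENNReal.ofReal δ :=
    measure_prod_deviation_gt_le hd hU (B := |M| + 1) (by positivity) hMB P.fst _ id
      (fun D x => deriv φ (s D x)) (fun D => ⟨s D, hs D, rfl⟩) hdm hδ
  have e3 : dataLaw P nU nR {D | width M d nR δ
      < |deviation (pairLaw P) Prod.fst (fun x => deriv φ (s D x)) D.2|} ≤ ENNReal.ofReal δ :=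
    measure_prod_deviation_gt_le' hd hR (B := |M| + 1) (by positivity) hMB (pairLaw P) _ Prod.fst
      (fun D x => deriv φ (s D x)) (fun D => ⟨s D, hs D, rfl⟩)
      (hdm.comp (measurable_fst.prodMk (measurable_fst.comp measurable_snd))) hδ
  have e4 : dataLaw P nU nR {D | width M d nR δ
      < |deviation (pairLaw P) Prod.snd (fun x => deriv φ (s D x)) D.2|} ≤ ENNReal.ofReal δ :=
    measure_prod_deviation_gt_le' hd hR (B := |M| + 1) (by positivity) hMB (pairLaw P) _ Prod.snd
      (fun D x => deriv φ (s D x)) (fun D => ⟨s D, hs D, rfl⟩)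
      (hdm.comp (measurable_fst.prodMk (measurable_snd.comp measurable_snd))) hδ
  simp only [SmallDeviations, not_and_or, not_le, Set.ofPred_or]
  refine (measure_union_le _ _).trans ?_
  rw [show (4 : ENNReal) * ENNReal.ofReal δ = ENNReal.ofReal δ + (ENNReal.ofReal δ
    + (ENNReal.ofReal δ + ENNReal.ofReal δ)) by ring]
  refine add_le_add e1 ((measure_union_le _ _).trans (add_le_add e2 ?_))
  exact (measure_union_le _ _).trans (add_le_add e3 e4)

/-- The excess-risk bound, with the failure event controlled in outer measure. -/
lemma IsProblem.measure_not_excess_le [IsProbabilityMeasure P]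
    (hP : IsProblem P Ys φ H m M) {d d' : ℕ}
    (hd : pseudoDim (derivClass φ H) ≤ (d : ℕ∞)) (hd' : pseudoDim (conjClass φ H) ≤ (d' : ℕ∞))
    {hstar : X → ℝ} (hstar_mem : hstar ∈ H) {nU nR : ℕ} (hU : 0 < nU) (hR : 0 < nR)
    {lam w₁ w₂ : ℝ} {hhat : RAData X nU nR → X → ℝ}
    (hhat_est : IsRAEstimator P φ H lam w₁ w₂ hhat) {δ : ℝ} (hδ : 0 < δ) :
    dataLaw P nU nR {D | ¬ risk P φ (hhat D) ≤ risk P φ hstar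
      + 2 * (width m d' nU (δ / 8) + |lam| * width M d nU (δ / 8))
      + 2 * (|w₁ - lam / 2| + |w₂ - lam / 2|) * width M d nR (δ / 8)
      + 2 * M * Err P w₁ w₂} ≤ ENNReal.ofReal δ := by
  -- Eight events share `δ`: four deviations for each of `hhat` and `hstar`.
  have hδ8 : 0 < δ / 8 := by positivity
  have b1 := hP.measure_deviations_le hd hd' hU hR hhat_est.mem hhat_est.measurable hδ8
  have b2 := hP.measure_deviations_le hd hd' hU hR (s := fun _ => hstar) (fun _ => hstar_mem)
    ((hP.model_measurable _ hstar_mem).comp measurable_snd) hδ8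
  have b3 := ae_iff.1 hhat_est.minimizes
  have hsub : {D : RAData X nU nR | ¬ risk P φ (hhat D) ≤ risk P φ hstar
      + 2 * (width m d' nU (δ / 8) + |lam| * width M d nU (δ / 8))
      + 2 * (|w₁ - lam / 2| + |w₂ - lam / 2|) * width M d nR (δ / 8)
      + 2 * M * Err P w₁ w₂} ⊆
      {D | ¬ SmallDeviations P φ m M d d' (δ / 8) D (hhat D)}
        ∪ {D | ¬ SmallDeviations P φ m M d d' (δ / 8) D hstar}
        ∪ {D | ¬ ∀ h ∈ H, empRisk P φ lam w₁ w₂ D (hhat D) ≤ empRisk P φ lam w₁ w₂ D h} := by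
    intro D hD
    by_contra hcon
    simp only [Set.mem_union, not_or, Set.mem_ofPred_eq, not_not] at hcon
    obtain ⟨⟨c1, c2⟩, c3⟩ := hcon
    have a1 := abs_le.1 (c1.abs_sub_le lam w₁ w₂)
    have a2 := abs_le.1 (c2.abs_sub_le lam w₁ w₂)
    have a3 := abs_le.1 (hP.abs_approxRisk_sub_risk_le lam w₁ w₂ (hhat_est.mem D))
    have a4 := abs_le.1 (hP.abs_approxRisk_sub_risk_le lam w₁ w₂ hstar_mem)
    have a5 := c3 hstar hstar_mem
    refine hD ?_
    linarith [a1.2, a2.1, a3.1, a4.2]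
  refine (measure_mono hsub).trans ((measure_union_le _ _).trans ?_)
  rw [b3, add_zero]
  refine (measure_union_le _ _).trans ((add_le_add b1 b2).trans (le_of_eq ?_))
  rw [← add_mul, ENNReal.ofReal_div_of_pos (by norm_num), mul_comm]
  norm_num
  exact ENNReal.div_mul_cancel (by norm_num) (by norm_num)

/-- Since `log (1 / δ) ≥ log (1 / δ₀) > 0`, the additive `1 + log 8` is absorbed into a multiple of
`log (1 / δ)`. This is what `δ₀ < 1` is for. -/
lemma width_div_eight_le (B : ℝ) (d n : ℕ) {δ δ₀ : ℝ} (hδ : 0 < δ) (hδ₀ : δ ≤ δ₀) (h1 : δ₀ < 1) :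
    width B d n (δ / 8) ≤ 256 * (|B| + 1) * (d + 1)
      * √(1 + (1 + Real.log 8) / Real.log (1 / δ₀)) * √(Real.log (1 / δ) / n) := by
  have hδ₀' : 0 < δ₀ := hδ.trans_le hδ₀
  have hL : 0 < Real.log (1 / δ₀) := Real.log_pos (by rw [lt_div_iff₀ hδ₀']; linarith)
  have hLδ : Real.log (1 / δ₀) ≤ Real.log (1 / δ) :=
    Real.log_le_log (by positivity) (one_div_le_one_div_of_le hδ hδ₀)
  have h8 : 0 ≤ 1 + Real.log 8 := by
    have := Real.log_nonneg (show (1 : ℝ) ≤ 8 by norm_num)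
    linarith
  rw [width, mul_assoc _ (√_) (√_), ← Real.sqrt_mul (by positivity)]
  gcongr
  rw [← mul_div_assoc]
  gcongr
  rw [show 1 / (δ / 8) = 8 * (1 / δ) by field_simp, Real.log_mul (by norm_num) (by positivity),
    add_mul, div_mul_eq_mul_div, one_mul]
  have : 1 + Real.log 8 ≤ (1 + Real.log 8) * Real.log (1 / δ) / Real.log (1 / δ₀) := by
    rw [le_div_iff₀ hL]
    gcongr
  linarith

lemma tendsto_width (B : ℝ) (d : ℕ) (δ : ℝ) :
    Tendsto (fun n : ℕ => width B d n δ) atTop (𝓝 0) := by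
  have h := (tendsto_const_div_atTop_nhds_zero_nat (1 + Real.log (1 / δ))).sqrt.const_mul
    (256 * (|B| + 1) * (d + 1))
  simpa [width] using h

end Excess

/-! ### Uniform targets -/

section Uniform

variable {X : Type u} [MeasurableSpace X] {P : Measure (X × ℝ)} [IsProbabilityMeasure P]

/-- On `[a, b]` the CDF is `(y - a) / (b - a)`, so `b F + a (1 - F)` interpolates linearly between
the endpoints and equals `y`. -/
lemma Err_eq_zero_of_isUniform {a b : ℝ} (hab : a < b)
    (hP : pdf.IsUniform Prod.snd (Set.Icc a b) P volume) : Err P (b / 2) (a / 2) = 0 := by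
  have hs : P.snd = cond volume (Set.Icc a b) := hP
  have hae : ∀ᵐ y ∂P.snd, y ∈ Set.Icc a b := by
    rw [hs]
    exact ae_cond_mem measurableSet_Icc
  have hcdf : ∀ y ∈ Set.Icc a b, cdf P.snd y = (y - a) / (b - a) := by
    intro y hy
    have hinter : Set.Icc a b ∩ Set.Iic y = Set.Icc a y := by
      ext z
      simp only [Set.mem_inter_iff, Set.mem_Icc, Set.mem_Iic]
      constructor
      · tauto
      · rintro ⟨h1, h2⟩
        exact ⟨⟨h1, h2.trans hy.2⟩, h2⟩
    rw [cdf_eq_real, hs, measureReal_def, cond_apply measurableSet_Icc, hinter, Real.volume_Icc,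
      Real.volume_Icc, ENNReal.toReal_mul, ENNReal.toReal_inv,
      ENNReal.toReal_ofReal (by linarith), ENNReal.toReal_ofReal (by linarith [hy.1]),
      inv_mul_eq_div]
  rw [Err, integral_eq_zero_of_ae]
  filter_upwards [hae] with y hy
  have hba : b - a ≠ 0 := by linarith
  rw [hcdf y hy, Pi.zero_apply, abs_eq_zero]
  field_simp
  ring

end Uniform

end UncoupledRegression

/-! ### The excess-risk bound and consistency -/

open UncoupledRegression in
theorem theorem2 :
    -- The excess-risk bound, with constants that depend only on the parameters listed first.
    (∀ (d d' : ℕ) (m M lam w₁ w₂ δ₀ : ℝ), δ₀ < 1 →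
      ∃ CU CR : ℝ,
        ∀ (X : Type u) [MeasurableSpace X] (P : Measure (X × ℝ)) [IsProbabilityMeasure P]
          (Ys : Set ℝ) (φ : ℝ → ℝ) (H : Set (X → ℝ)),
          IsProblem P Ys φ H m M →
          pseudoDim (derivClass φ H) ≤ (d : ℕ∞) →
          pseudoDim (conjClass φ H) ≤ (d' : ℕ∞) →
          ∀ hstar : X → ℝ, IsRiskMinimizer P φ H hstar →
          ∀ nU nR : ℕ, 0 < nU → 0 < nR →
          ∀ hhat : RAData X nU nR → X → ℝ, IsRAEstimator P φ H lam w₁ w₂ hhat →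
          ∀ δ : ℝ, 0 < δ → δ ≤ δ₀ →
            ENNReal.ofReal (1 - δ) ≤ dataLaw P nU nR
              {D | risk P φ (hhat D) ≤ risk P φ hstar
                + CU * Real.sqrt (Real.log (1 / δ) / (nU : ℝ))
                + CR * Real.sqrt (Real.log (1 / δ) / (nR : ℝ))
                + 2 * M * Err P w₁ w₂}) ∧
    -- Uniform targets: the approximation error vanishes and the estimator is consistent.
    (∀ (X : Type u) [MeasurableSpace X] (P : Measure (X × ℝ)) [IsProbabilityMeasure P] (a b : ℝ),
      a < b → pdf.IsUniform Prod.snd (Set.Icc a b) P volume →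
      Err P (b / 2) (a / 2) = 0 ∧
      ∀ (Ys : Set ℝ) (φ : ℝ → ℝ) (H : Set (X → ℝ)) (m M lam : ℝ),
        IsProblem P Ys φ H m M →
        pseudoDim (derivClass φ H) < ⊤ →
        pseudoDim (conjClass φ H) < ⊤ →
        ∀ hstar : X → ℝ, IsRiskMinimizer P φ H hstar →
        ∀ hhat : (nU nR : ℕ) → RAData X nU nR → X → ℝ,
          (∀ nU nR : ℕ, 0 < nU → 0 < nR →
            IsRAEstimator P φ H lam (b / 2) (a / 2) (hhat nU nR)) →
          ∀ ε : ℝ, 0 < ε →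
            Tendsto (fun n : ℕ × ℕ => dataLaw P n.1 n.2
              {D | ε < |risk P φ (hhat n.1 n.2 D) - risk P φ hstar|})
              (atTop ×ˢ atTop) (𝓝 0)) := by
  refine ⟨?_, ?_⟩
  · intro d d' m M lam w₁ w₂ δ₀ hδ₀
    set c := √(1 + (1 + Real.log 8) / Real.log (1 / δ₀))
    refine ⟨2 * (256 * (|m| + 1) * (d' + 1) * c + |lam| * (256 * (|M| + 1) * (d + 1) * c)),
      2 * (|w₁ - lam / 2| + |w₂ - lam / 2|) * (256 * (|M| + 1) * (d + 1) * c), ?_⟩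
    intro X _ P _ Ys φ H hP hd hd' hstar hmin nU nR hU hR hhat hest δ hδ hδδ₀
    have hbad := hP.measure_not_excess_le hd hd' hmin.1 hU hR hest hδ
    set good : Set (RAData X nU nR) := {D | risk P φ (hhat D) ≤ risk P φ hstar
      + 2 * (width m d' nU (δ / 8) + |lam| * width M d nU (δ / 8))
      + 2 * (|w₁ - lam / 2| + |w₂ - lam / 2|) * width M d nR (δ / 8)
      + 2 * M * Err P w₁ w₂} with hgood
    change dataLaw P nU nR goodᶜ ≤ _ at hbad
    -- Subadditivity suffices, so the event need not be shown measurable.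
    have hone : 1 ≤ dataLaw P nU nR good + dataLaw P nU nR goodᶜ := by
      rw [← measure_univ (μ := dataLaw P nU nR), ← Set.union_compl_self good]
      exact measure_union_le _ _
    have hge : ENNReal.ofReal (1 - δ) ≤ dataLaw P nU nR good := by
      rw [ENNReal.ofReal_sub _ hδ.le, ENNReal.ofReal_one]
      exact tsub_le_iff_right.2 (hone.trans (add_le_add le_rfl hbad))
    refine hge.trans (measure_mono fun D hD => ?_)
    simp only [hgood, Set.mem_ofPred_eq] at hD ⊢
    have e1 := width_div_eight_le m d' nU hδ hδδ₀ hδ₀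
    have e2 := mul_le_mul_of_nonneg_left (width_div_eight_le M d nU hδ hδδ₀ hδ₀) (abs_nonneg lam)
    have e3 := mul_le_mul_of_nonneg_left (width_div_eight_le M d nR hδ hδδ₀ hδ₀)
      (show 0 ≤ 2 * (|w₁ - lam / 2| + |w₂ - lam / 2|) by positivity)
    change _ ≤ _ * c * _ at e1
    change _ ≤ |lam| * (_ * c * _) at e2
    change _ ≤ _ * (_ * c * _) at e3
    nlinarith only [hD, e1, e2, e3]
  · intro X _ P _ a b hab hunif
    have hErr := Err_eq_zero_of_isUniform hab hunif
    refine ⟨hErr, ?_⟩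
    intro Ys φ H m M lam hP hd hd' hstar hmin hhat hest ε hε
    obtain ⟨d, hd⟩ := ENat.ne_top_iff_exists.1 hd.ne
    obtain ⟨d', hd'⟩ := ENat.ne_top_iff_exists.1 hd'.ne
    rw [ENNReal.tendsto_nhds_zero]
    intro η hη
    -- `η` may be infinite; capping it at `1` gives a positive real confidence level.
    set δ := (min η 1).toReal with hδdef
    have hfin : min η 1 ≠ ⊤ := (min_lt_of_right_lt ENNReal.one_lt_top).ne
    have hδ : 0 < δ := ENNReal.toReal_pos (lt_min hη one_pos).ne' hfin
    have hδη : ENNReal.ofReal δ ≤ η := by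
      rw [hδdef, ENNReal.ofReal_toReal hfin]
      exact min_le_left _ _
    have hlim : Tendsto (fun n : ℕ × ℕ =>
        2 * (width m d' n.1 (δ / 8) + |lam| * width M d n.1 (δ / 8))
          + 2 * (|b / 2 - lam / 2| + |a / 2 - lam / 2|) * width M d n.2 (δ / 8))
        (atTop ×ˢ atTop) (𝓝 0) := by
      have t1 := (tendsto_width m d' (δ / 8)).comp
        (tendsto_fst (f := (atTop : Filter ℕ)) (g := (atTop : Filter ℕ)))
      have t2 := (tendsto_width M d (δ / 8)).comp
        (tendsto_fst (f := (atTop : Filter ℕ)) (g := (atTop : Filter ℕ)))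
      have t3 := (tendsto_width M d (δ / 8)).comp
        (tendsto_snd (f := (atTop : Filter ℕ)) (g := (atTop : Filter ℕ)))
      simpa using ((t1.add (t2.const_mul |lam|)).const_mul 2).add
        (t3.const_mul (2 * (|b / 2 - lam / 2| + |a / 2 - lam / 2|)))
    filter_upwards [hlim.eventually_le_const hε,
      tendsto_fst.eventually (eventually_gt_atTop 0),
      tendsto_snd.eventually (eventually_gt_atTop 0)] with n hn hU hR
    have hbad := hP.measure_not_excess_le hd.ge hd'.ge hmin.1 hU hR (hest n.1 n.2 hU hR) hδ
    refine (measure_mono fun D hD => ?_).trans (hbad.trans hδη)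
    simp only [Set.mem_ofPred_eq] at hD ⊢
    -- As `hstar` minimizes the risk over `H`, the excess is nonnegative and the one-sided bound
    -- controls its absolute value.
    have hnonneg := hmin.2 _ ((hest n.1 n.2 hU hR).mem D)
    rw [abs_of_nonneg (by linarith)] at hD
    rw [hErr]
    linarith
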